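/- **Setting.** Let $V=\mathbb R^7$ with standard inner product, orientation, basis $e_1,\dots,e_7$ and dual basis $e^1,\dots,e^7$, and let $$\phi_0=e^{123}+e^1\wedge(e^{45}+e^{67})+e^2\wedge(e^{46}-e^{57})+e^3\wedge(-e^{47}-e^{56}).$$ A $\mathrm G_2$-structure on a smooth $7$-manifold $M$ is a smooth $3$-form $\varphi$ such that at each $x\in M$ there is a linear isomorphism $u:T_xM\to V$ with $\varphi|_x=u^*\phi_0$; any such $u$ identifies $(T_xM,\varphi|_x)$ with $(V,\phi_0)$ and induces a metric, an orientation and a Hodge star $*$ on $T_xM$, which do not depend on $u$. The torsion forms $(\tau_0,\tau_1,\tau_2,\tau_3)\in\Omega^0\oplus\Omega^1\oplus\Omega^2\oplus\Omega^3$ of $\varphi$ are defined by $$d\varphi=\tau_0*\varphi+3\tau_1\wedge\varphi+*\tau_3,\qquad d{*\varphi}=4\tau_1\wedge*\varphi+\tau_2\wedge\varphi,$$ together with $*(\varphi\wedge\tau_2)=-\tau_2$, $\tau_3\wedge\varphi=0$ and $\tau_3\wedge*\varphi=0$. A $4$-plane $C\subset T_xM\simeq V$ is coassociative if $*\phi_0(x,y,z,w)=\pm1$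 for every orthonormal basis $(x,y,z,w)$ of $C$. A coassociative $4$-fold in $M$ is a smooth immersion $f:\Sigma\to M$ of a smooth $4$-manifold all of whose tangent planes $df(T_p\Sigma)$ are coassociative. Let $\mathsf i$ be the linear map from symmetric bilinear forms on $V$ to $\Lambda^3(V^*)$ with $\mathsf i(\alpha\circ\beta)=\alpha\wedge*(\beta\wedge*\phi_0)+\beta\wedge*(\alpha\wedge*\phi_0)$. For a coassociative $4$-plane $C$ with orthogonal complement $A$, put $E_0=4\,\mathrm{Id}_A-3\,\mathrm{Id}_C$. The space $\Lambda^3_{27}=\{\gamma\in\Lambda^3(V^*):\gamma\wedge\phi_0=0,\ \gamma\wedge*\phi_0=0\}$ is the direct sum of the line $(\Lambda^3_{27})_{0,0}=\mathbb R\,\mathsf i(E_0)$ and of the images under $\mathsf i$ of the traceless symmetric forms on $A$, of the traceless symmetric forms on $C$, and of the symmetric forms in $A^*\otimes C^*$. For $\gamma\in\Lambda^3_{27}$ let $\gamma_{0,0}$ be its component in $(\Lambda^3_{27})_{0,0}$, and let $\dagger:(\Lambda^3_{27})_{0,0}\to\mathbb R$ be the linear isomorphism with $[\mathsf i(E_0)]^\dagger=4\sqrt{42}$.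 **Theorem.** Let $M$ be a smooth $7$-manifold with a $\mathrm G_2$-structure $\varphi$ and torsion forms $\tau_0,\tau_1,\tau_2,\tau_3$. 1. If $f:\Sigma\to M$ is a coassociative $4$-fold, then for every $p\in\Sigma$ the $3$-form $\tau_3|_{f(p)}$ has a unique component $(\tau_3)_{0,0}\in(\Lambda^3_{27})_{0,0}$ relative to the tangent plane $C=df(T_p\Sigma)$, and at $f(p)$ $$\tau_0=-\frac{\sqrt{42}}{7}\,[(\tau_3)_{0,0}]^\dagger .$$ 2. In particular, if $U\subset M$ is open (for example $U=M$), $\tau_3=0$ on $U$ and $\tau_0$ vanishes nowhere on $U$, then no non-empty coassociative $4$-fold $f:\Sigma\to M$ has its image in $U$. -/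

import Mathlib

open scoped Manifold ContDiff

noncomputable section

namespace G2

/-! ### Wedge product of alternating forms -/

section Wedge

variable {E : Type*} [AddCommGroup E] [Module ℝ E] [TopologicalSpace E]

/-- The tensor product `α ⊗ β` of two alternating forms, as a multilinear form:
`(v₁, …, v_{k+l}) ↦ α(v₁, …, v_k) β(v_{k+1}, …, v_{k+l})`. -/
def tensor {k l : ℕ} (α : E [⋀^Fin k]→L[ℝ] ℝ) (β : E [⋀^Fin l]→L[ℝ] ℝ) :
    ContinuousMultilinearMap ℝ (fun _ : Fin (k + l) => E) ℝ where
  toFun v := α (fun i => v (Fin.castAdd l i)) * β (fun j => v (Fin.natAdd k j))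
  map_update_add' {inst} v i x y := by
    have : inst = instDecidableEqFin (k + l) := Subsingleton.elim _ _
    subst this
    induction i using Fin.addCases with
    | left i =>
      have h1 : ∀ z, (fun a => Function.update v (Fin.castAdd l i) z (Fin.castAdd l a)) =
          Function.update (fun a => v (Fin.castAdd l a)) i z := fun z =>
        Function.update_comp_eq_of_injective v (Fin.castAdd_injective k l) i z
      have h2 : ∀ z, (fun a => Function.update v (Fin.castAdd l i) z (Fin.natAdd k a)) =
          fun a => v (Fin.natAdd k a) := fun z => by
        funext a
        refine Function.update_of_ne (fun h => ?_) _ _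
        have := congrArg Fin.val h
        have hi := i.isLt
        simp at this
        omega
      simp only [h1, h2, α.map_update_add, add_mul]
    | right i =>
      have h1 : ∀ z, (fun a => Function.update v (Fin.natAdd k i) z (Fin.natAdd k a)) =
          Function.update (fun a => v (Fin.natAdd k a)) i z := fun z =>
        Function.update_comp_eq_of_injective v (Fin.natAdd_injective l k) i z
      have h2 : ∀ z, (fun a => Function.update v (Fin.natAdd k i) z (Fin.castAdd l a)) =
          fun a => v (Fin.castAdd l a) := fun z => by
        funext a
        refine Function.update_of_ne (fun h => ?_) _ _
        have := congrArg Fin.val h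
        have ha := a.isLt
        simp at this
        omega
      simp only [h1, h2, β.map_update_add, mul_add]
  map_update_smul' {inst} v i c x := by
    have : inst = instDecidableEqFin (k + l) := Subsingleton.elim _ _
    subst this
    induction i using Fin.addCases with
    | left i =>
      have h1 : ∀ z, (fun a => Function.update v (Fin.castAdd l i) z (Fin.castAdd l a)) =
          Function.update (fun a => v (Fin.castAdd l a)) i z := fun z =>
        Function.update_comp_eq_of_injective v (Fin.castAdd_injective k l) i z
      have h2 : ∀ z, (fun a => Function.update v (Fin.castAdd l i) z (Fin.natAdd k a)) =
          fun a => v (Fin.natAdd k a) := fun z => by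
        funext a
        refine Function.update_of_ne (fun h => ?_) _ _
        have := congrArg Fin.val h
        have hi := i.isLt
        simp at this
        omega
      simp only [h1, h2, α.map_update_smul, smul_eq_mul, mul_assoc]
    | right i =>
      have h1 : ∀ z, (fun a => Function.update v (Fin.natAdd k i) z (Fin.natAdd k a)) =
          Function.update (fun a => v (Fin.natAdd k a)) i z := fun z =>
        Function.update_comp_eq_of_injective v (Fin.natAdd_injective l k) i z
      have h2 : ∀ z, (fun a => Function.update v (Fin.natAdd k i) z (Fin.castAdd l a)) =
          fun a => v (Fin.castAdd l a) := fun z => by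
        funext a
        refine Function.update_of_ne (fun h => ?_) _ _
        have := congrArg Fin.val h
        have ha := a.isLt
        simp at this
        omega
      simp only [h1, h2, β.map_update_smul, smul_eq_mul, mul_left_comm]
  cont := by
    refine Continuous.mul ?_ ?_
    · exact α.cont.comp (continuous_pi fun i => continuous_apply _)
    · exact β.cont.comp (continuous_pi fun i => continuous_apply _)

/-- The wedge product, with the convention `(e¹ ∧ e²)(e₁, e₂) = 1`, i.e.
`(α ∧ β)(v) = (1 / (k! l!)) ∑_σ sgn σ · α(v_{σ 1}, …, v_{σ k}) β(v_{σ (k+1)}, …)`. -/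
def wedge {k l : ℕ} (α : E [⋀^Fin k]→L[ℝ] ℝ) (β : E [⋀^Fin l]→L[ℝ] ℝ) :
    E [⋀^Fin (k + l)]→L[ℝ] ℝ :=
  ((k.factorial * l.factorial : ℕ) : ℝ)⁻¹ • (tensor α β).alternatization

end Wedge

/-! ### Linear algebra on `V = ℝ⁷` -/

/-- `V = ℝ⁷` with its standard inner product. -/
abbrev V : Type := EuclideanSpace ℝ (Fin 7)

/-- `Λᵏ(V*)`. -/
abbrev Lam (k : ℕ) : Type := V [⋀^Fin k]→L[ℝ] ℝ

/-- The standard basis vectors; the indices `0, …, 6` stand for `1, …, 7`. -/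
def e (i : Fin 7) : V := EuclideanSpace.single i 1

/-- The dual basis, as 1-forms. -/
def dual (i : Fin 7) : Lam 1 :=
  ContinuousAlternatingMap.ofSubsingleton ℝ V ℝ (0 : Fin 1) (EuclideanSpace.proj i)

/-- `eⁱ ∧ eʲ ∧ eᵏ`. -/
def dual3 (i j k : Fin 7) : Lam 3 := wedge (dual i) (wedge (dual j) (dual k))

/-- The associative 3-form. -/
def phi0 : Lam 3 :=
  dual3 0 1 2 + dual3 0 3 4 + dual3 0 5 6 + dual3 1 3 5 - dual3 1 4 6 - dual3 2 3 6 - dual3 2 4 5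

/-- The volume form of `V`: the determinant of the matrix of coordinates. -/
def vol (v : Fin 7 → V) : ℝ := Matrix.det (Matrix.of fun i j => v i j)

/-- `(e_{i₁}, …, e_{i_k}, v₁, …, v_l)` as a family of `k + l = 7` vectors. -/
def frame {k l : ℕ} (h : k + l = 7) (i : Fin k → Fin 7) (v : Fin l → V) : Fin 7 → V :=
  fun b => Fin.append (fun a => e (i a)) v (Fin.cast h.symm b)

theorem frame_update {k l : ℕ} (h : k + l = 7) (i : Fin k → Fin 7) (v : Fin l → V)
    (j : Fin l) (x : V) :
    frame h i (Function.update v j x) =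
      Function.update (frame h i v) (Fin.cast h (Fin.natAdd k j)) x := by
  funext b
  obtain ⟨c, rfl⟩ : ∃ c : Fin (k + l), b = Fin.cast h c := ⟨Fin.cast h.symm b, by simp⟩
  induction c using Fin.addCases with
  | left a =>
    rw [Function.update_of_ne]
    · simp [frame]
    · intro hh
      have := congrArg Fin.val hh
      have ha := a.isLt
      simp at this
      omega
  | right a =>
    by_cases haj : a = j
    · subst haj
      simp [frame]
    · rw [Function.update_of_ne]
      · simp [frame, haj]
      · intro hh
        apply haj
        have := congrArg Fin.val hh
        simp at this
        exact Fin.ext this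

theorem vol_eq_det_update (w : Fin 7 → V) (b : Fin 7) (x : V) :
    vol (Function.update w b x) =
      Matrix.det ((Matrix.of fun i j => w i j).updateRow b (fun j => x j)) := by
  unfold vol
  congr 1
  ext i j
  by_cases hi : i = b
  · subst hi
    simp
  · simp [hi]

/-- The Hodge star `Λᵏ(V*) → Λˡ(V*)`, `k + l = 7`:
`(*α)(v₁, …, v_l) = (1 / k!) ∑ α(e_{i₁}, …, e_{i_k}) vol(e_{i₁}, …, e_{i_k}, v₁, …, v_l)`,
the sum over all `i₁, …, i_k`; so `*eᴵ = ± eᴶ` with `J` complementary to `I` and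
`eᴵ ∧ *eᴵ = vol`. -/
def star {k l : ℕ} (h : k + l = 7) (α : Lam k) : Lam l where
  toFun v := (k.factorial : ℝ)⁻¹ * ∑ i : Fin k → Fin 7, α (fun a => e (i a)) * vol (frame h i v)
  map_update_add' {inst} v j x y := by
    have : inst = instDecidableEqFin l := Subsingleton.elim _ _
    subst this
    rw [← mul_add, ← Finset.sum_add_distrib]
    congr 1
    refine Finset.sum_congr rfl fun i _ => ?_
    rw [← mul_add]
    congr 1
    simp only [frame_update, vol_eq_det_update]
    exact Matrix.det_updateRow_add _ _ _ _
  map_update_smul' {inst} v j c x := by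
    have : inst = instDecidableEqFin l := Subsingleton.elim _ _
    subst this
    rw [smul_eq_mul, mul_left_comm]
    congr 1
    rw [Finset.mul_sum]
    refine Finset.sum_congr rfl fun i _ => ?_
    rw [mul_left_comm]
    congr 1
    simp only [frame_update, vol_eq_det_update]
    exact Matrix.det_updateRow_smul _ _ _ _
  map_eq_zero_of_eq' v a b hab hne := by
    refine mul_eq_zero_of_right _ (Finset.sum_eq_zero fun i _ => mul_eq_zero_of_right _ ?_)
    refine Matrix.det_zero_of_row_eq (i := Fin.cast h (Fin.natAdd k a))
      (j := Fin.cast h (Fin.natAdd k b)) (fun hh => hne ?_) ?_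
    · have := congrArg Fin.val hh
      simp at this
      exact Fin.ext this
    · funext c
      simp [frame, hab]
  cont := by
    refine continuous_const.mul (continuous_finsetSum _ fun i _ => continuous_const.mul ?_)
    have key : ∀ b c : Fin 7, Continuous fun v : Fin l → V => frame h i v b c := fun b c => by
      obtain ⟨d, rfl⟩ : ∃ d : Fin (k + l), b = Fin.cast h d := ⟨Fin.cast h.symm b, by simp⟩
      induction d using Fin.addCases with
      | left a => simpa [frame] using continuous_const
      | right a =>
        simp only [frame, Fin.cast_cast, Fin.cast_eq_self, Fin.append_right]
        fun_prop
    exact Continuous.matrix_det (A := fun v => Matrix.of fun b c => frame h i v b c)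
      (continuous_matrix key)

/-- The coassociative 4-form `*φ₀`. -/
def starPhi0 : Lam 4 := star (k := 3) (by norm_num) phi0

/-- A coassociative 4-plane: `*φ₀(x, y, z, w) = ±1` on every orthonormal basis. -/
def IsCoassociativePlane (C : Submodule ℝ V) : Prop :=
  Module.finrank ℝ C = 4 ∧
    ∀ b : OrthonormalBasis (Fin 4) ℝ C, |starPhi0 (fun i => (b i : V))| = 1

/-- The trace of a bilinear form. -/
def trace (h : LinearMap.BilinForm ℝ V) : ℝ := ∑ i, h (e i) (e i)

/-- The map `i`, determined by `i(α ∘ β) = α ∧ *(β ∧ *φ₀) + β ∧ *(α ∧ *φ₀)`; in coordinates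
a symmetric form `h` is `∑ h_{ij} eⁱ ∘ eʲ`. -/
def iMap (h : LinearMap.BilinForm ℝ V) : Lam 3 :=
  ∑ i, ∑ j, h (e i) (e j) •
    ((wedge (dual i) (star (l := 2) (by norm_num) (wedge (dual j) starPhi0)) : Lam 3) +
      (wedge (dual j) (star (l := 2) (by norm_num) (wedge (dual i) starPhi0)) : Lam 3))

/-- `Sym²₀(S)`, the traceless symmetric forms on the subspace `S`, extended by zero on `Sᗮ`. -/
def Sym20 (S : Submodule ℝ V) : Set (LinearMap.BilinForm ℝ V) :=
  {h | (∀ v w, h v w = h w v) ∧ (∀ v ∈ Sᗮ, ∀ w, h v w = 0) ∧ trace h = 0}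

/-- The symmetric forms in `S* ⊗ (Sᗮ)*`, i.e. those vanishing on `S × S` and on `Sᗮ × Sᗮ`. -/
def SymMixed (S : Submodule ℝ V) : Set (LinearMap.BilinForm ℝ V) :=
  {h | (∀ v w, h v w = h w v) ∧ (∀ v ∈ S, ∀ w ∈ S, h v w = 0) ∧ ∀ v ∈ Sᗮ, ∀ w ∈ Sᗮ, h v w = 0}

/-- `E₀ = 4 Id_A - 3 Id_C = diag(4, 4, 4, -3, -3, -3, -3)` for the splitting `V = A ⊕ C`,
`A = Cᗮ`. -/
def E0 (C : Submodule ℝ V) : LinearMap.BilinForm ℝ V :=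
  (4 : ℝ) • (innerₗ V).compl₁₂ (Cᗮ.starProjection : V →ₗ[ℝ] V) (Cᗮ.starProjection : V →ₗ[ℝ] V) -
  (3 : ℝ) • (innerₗ V).compl₁₂ (C.starProjection : V →ₗ[ℝ] V) (C.starProjection : V →ₗ[ℝ] V)

/-- The line `(Λ³₂₇)_{0,0} = ℝ i(E₀)` of the splitting `V = A ⊕ C`, `A = Cᗮ`. -/
def Lam27Inv (C : Submodule ℝ V) : Submodule ℝ (Lam 3) := Submodule.span ℝ {iMap (E0 C)}

/-- `γ₀` is the component in `(Λ³₂₇)_{0,0}` of `γ` with respect to the decomposition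
`Λ³₂₇ = ℝ i(E₀) ⊕ i(Sym²₀(A)) ⊕ i(Sym²₀(C)) ⊕ i(A ⊗ C)`, where `A = Cᗮ`. (The last summand is the
sum of the remaining two `SO(4)`-irreducible summands.) -/
def IsInvComponent (C : Submodule ℝ V) (γ : Lam 3) (γ₀ : Lam27Inv C) : Prop :=
  ∃ a ∈ Sym20 Cᗮ, ∃ c ∈ Sym20 C, ∃ m ∈ SymMixed C, γ = γ₀ + iMap a + iMap c + iMap m

open Classical in
/-- The linear isomorphism `† : (Λ³₂₇)_{0,0} → ℝ` with `i(E₀)† = 4√42`. (The generator `i(E₀)` of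
the line is never zero for a coassociative plane `C`; the zero map is a dummy value.) -/
def dagger (C : Submodule ℝ V) : Lam27Inv C →ₗ[ℝ] ℝ :=
  if h : iMap (E0 C) ≠ 0 then
    (4 * √42) • (LinearEquiv.toSpanNonzeroSingleton ℝ (Lam 3) (iMap (E0 C)) h).symm.toLinearMap
  else 0

/-! ### Differential forms on 7-manifolds -/

section Manifold

variable {M : Type*} [TopologicalSpace M] [ChartedSpace V M]

variable (M) in
/-- A (not necessarily smooth) field of alternating `k`-forms on the tangent spaces of `M`. -/
abbrev FormField (k : ℕ) : Type _ := (x : M) → (TangentSpace 𝓘(ℝ, V) x) [⋀^Fin k]→L[ℝ] ℝ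

/-- The expression of a form in the preferred chart at `x₀`: its pullback by the inverse chart. -/
def inChart {k : ℕ} (η : FormField M k) (x₀ : M) (y : V) : Lam k :=
  (η ((chartAt V x₀).symm y)).compContinuousLinearMap
    (mfderiv 𝓘(ℝ, V) 𝓘(ℝ, V) (chartAt V x₀).symm y)

/-- Smoothness of a differential form. -/
def IsSmoothForm {k : ℕ} (η : FormField M k) : Prop :=
  ∀ x₀ : M, ContDiffOn ℝ ∞ (inChart η x₀) (chartAt V x₀).target

/-- The exterior derivative, computed at `x` in the preferred chart at `x`. -/
def extD {k : ℕ} (η : FormField M k) : FormField M (k + 1) := fun x =>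
  (extDeriv (inChart η x) (chartAt V x x)).compContinuousLinearMap
    (mfderiv 𝓘(ℝ, V) 𝓘(ℝ, V) (chartAt V x) x)

variable (M) in
/-- A `G₂`-structure: a smooth 3-form `φ` such that at each `x` there is a coframe
`u : T_xM → ℝ⁷` with `φ_x = u^* φ₀`. -/
structure G2Structure where
  form : FormField M 3
  smooth : IsSmoothForm form
  exists_coframe : ∀ x : M, ∃ u : TangentSpace 𝓘(ℝ, V) x ≃L[ℝ] V,
    form x = phi0.compContinuousLinearMap (u : TangentSpace 𝓘(ℝ, V) x →L[ℝ] V)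

namespace G2Structure

/-- An identification `(T_xM, φ_x) ≃ (V, φ₀)`. Two of them differ by an element of
`G₂ ⊂ SO(7)`, so that the notions transported from `V` below do not depend on the choice. -/
def coframe (φ : G2Structure M) (x : M) : TangentSpace 𝓘(ℝ, V) x ≃L[ℝ] V :=
  (φ.exists_coframe x).choose

/-- A form on `T_xM`, seen on `V` through the identification `T_xM ≃ V`. -/
def toModel (φ : G2Structure M) {k : ℕ} {x : M}
    (α : (TangentSpace 𝓘(ℝ, V) x) [⋀^Fin k]→L[ℝ] ℝ) : Lam k :=
  α.compContinuousLinearMap ((φ.coframe x).symm : V →L[ℝ] TangentSpace 𝓘(ℝ, V) x)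

/-- The Hodge star of the metric and the orientation that `φ` induces on `T_xM`. -/
def hodge (φ : G2Structure M) {k l : ℕ} (h : k + l = 7) {x : M}
    (α : (TangentSpace 𝓘(ℝ, V) x) [⋀^Fin k]→L[ℝ] ℝ) : (TangentSpace 𝓘(ℝ, V) x) [⋀^Fin l]→L[ℝ] ℝ :=
  (star h (φ.toModel α)).compContinuousLinearMap
    (φ.coframe x : TangentSpace 𝓘(ℝ, V) x →L[ℝ] V)

/-- The 4-form `*φ`. -/
def starForm (φ : G2Structure M) : FormField M 4 := fun x => φ.hodge (by norm_num) (φ.form x)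

/-- `τ₀, τ₁, τ₂, τ₃` are the torsion forms of `φ`. -/
structure IsTorsion (φ : G2Structure M) (τ₀ : M → ℝ) (τ₁ : FormField M 1) (τ₂ : FormField M 2)
    (τ₃ : FormField M 3) : Prop where
  d_form : ∀ x, extD φ.form x =
    τ₀ x • φ.starForm x + (3 : ℝ) • wedge (τ₁ x) (φ.form x) + φ.hodge (by norm_num) (τ₃ x)
  d_starForm : ∀ x, extD φ.starForm x =
    (4 : ℝ) • wedge (τ₁ x) (φ.starForm x) + wedge (τ₂ x) (φ.form x)
  tau2_mem : ∀ x, φ.hodge (by norm_num) (wedge (φ.form x) (τ₂ x)) = -τ₂ x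
  tau3_mem : ∀ x, wedge (τ₃ x) (φ.form x) = 0
  tau3_mem' : ∀ x, wedge (τ₃ x) (φ.starForm x) = 0

/-- The model space of a 4-manifold. -/
abbrev _root_.G2.R4 : Type := EuclideanSpace ℝ (Fin 4)

variable {S : Type*} [TopologicalSpace S] [ChartedSpace R4 S]

/-- The tangent plane at `p` of a map `f : S → M` from a 4-manifold, inside `T_{f p}M ≃ V`. -/
def tangentPlane (φ : G2Structure M) (f : S → M) (p : S) : Submodule ℝ V :=
  Submodule.map ((φ.coframe (f p)).toLinearEquiv.toLinearMap)
    (mfderiv 𝓘(ℝ, R4) 𝓘(ℝ, V) f p).range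

/-- `f : S → M` is an immersed coassociative 4-fold. -/
structure IsCoassociative (φ : G2Structure M) (f : S → M) : Prop where
  smooth : ContMDiff 𝓘(ℝ, R4) 𝓘(ℝ, V) ∞ f
  immersion : ∀ p, Function.Injective (mfderiv 𝓘(ℝ, R4) 𝓘(ℝ, V) f p)
  coassociative : ∀ p, IsCoassociativePlane (φ.tangentPlane f p)

end G2Structure

end Manifold

end G2

end

noncomputable section

namespace G2

/-! On a coassociative plane `φ₀` vanishes. This follows from the identity `|*φ₀(x,y,z,·)|² +
φ₀(x,y,z)² = |x∧y∧z|²` (`sum_starPhi0_sq`): if `|*φ₀(x,y,z,w)| = 1` on an orthonormal quadruple,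
then the vector dual to `*φ₀(x,y,z,·)` already has full length `1` along `w`, so it is `±w` and
nothing is left for `φ₀(x,y,z)` (`calibrated`). Hence `f^*φ = 0` for a coassociative `f`, and `f^*dφ
= 0` by naturality of the exterior derivative (`extD_pullback_eq_zero`). In the formula for `dφ` the
term `τ₁ ∧ φ` also restricts to zero, which leaves `τ₀ *φ + *τ₃ = 0` on every tangent plane `C`.

It remains to evaluate `*τ₃` on `C`. The map `i` is an isomorphism from traceless symmetric forms
onto `Λ³₂₇` (`exists_iMap_eq`, `eq_zero_of_iMap_eq_zero`), so `τ₃ = i(h)`. The Hodge star of `i(h)`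
is `2 (tr h) *φ₀ - 2 h·*φ₀`, where `h` acts as a derivation (`star_iMap`). By the same calibration
argument, replacing a vector of an orthonormal basis of `C` by `u` only sees the component of `u`
along that vector (`starPhi0_update`), so `*i(h)` restricts to `-2 (tr_C h) *φ₀` on `C`
(`star_iMap_basis`).

Among the summands of `Λ³₂₇` only the line of `i(E₀)` has nonzero trace on `C`, namely `tr_C E₀ =
-12`. If the component of `τ₃` is `t i(E₀)`, then `*τ₃ = 24 t *φ₀` on `C`, whence `τ₀ = -24 t`;
since `†` takes the value `4√42 t` and `(√42/7)·4√42 = 24`, this is the asserted formula. If `τ₃ =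
0`, the component is `0` and `τ₀` must vanish along the image. -/

/-! ### Wedge products and the Hodge star as contractions. -/

theorem wedge_apply {E : Type*} [AddCommGroup E] [Module ℝ E] [TopologicalSpace E] {k l : ℕ}
    (α : E [⋀^Fin k]→L[ℝ] ℝ) (β : E [⋀^Fin l]→L[ℝ] ℝ) (v : Fin (k + l) → E) :
    wedge α β v = ((k.factorial * l.factorial : ℕ) : ℝ)⁻¹ *
      ∑ σ : Equiv.Perm (Fin (k + l)), ((Equiv.Perm.sign σ : ℤ) : ℝ) *
        (α (fun i => v (σ (Fin.castAdd l i))) * β (fun j => v (σ (Fin.natAdd k j)))) := by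
  simp only [wedge, ContinuousAlternatingMap.smul_apply, smul_eq_mul,
    ContinuousMultilinearMap.alternatization_apply_apply]
  congr 1
  refine Finset.sum_congr rfl fun σ _ => ?_
  rw [Units.smul_def, zsmul_eq_mul]
  rfl

theorem wedge_comp {E F : Type*} [AddCommGroup E] [Module ℝ E] [TopologicalSpace E]
    [AddCommGroup F] [Module ℝ F] [TopologicalSpace F] {k l : ℕ}
    (α : E [⋀^Fin k]→L[ℝ] ℝ) (β : E [⋀^Fin l]→L[ℝ] ℝ) (f : F →L[ℝ] E) :
    (wedge α β).compContinuousLinearMap f =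
      wedge (α.compContinuousLinearMap f) (β.compContinuousLinearMap f) := by
  ext v
  simp [wedge_apply, Function.comp_def]

/-- The pairing of two functions of `k` vectors, summed over the standard basis;
for alternating forms it is the inner product. -/
def pairing {k : ℕ} (α W : (Fin k → V) → ℝ) : ℝ :=
  (k.factorial : ℝ)⁻¹ * ∑ I : Fin k → Fin 7, α (fun a => e (I a)) * W (fun a => e (I a))

/-- Functions of `n` vectors which change sign under odd permutations. -/
def IsSkew {n : ℕ} (W : (Fin n → V) → ℝ) : Prop :=
  ∀ (σ : Equiv.Perm (Fin n)) (v : Fin n → V), W (v ∘ σ) = ((Equiv.Perm.sign σ : ℤ) : ℝ) * W v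

theorem isSkew_form {n : ℕ} (α : Lam n) : IsSkew α := fun σ v => by
  have := α.toAlternatingMap.map_perm v σ
  rw [Units.smul_def, zsmul_eq_mul] at this
  exact this

theorem isSkew_vol : IsSkew vol := fun σ v => by
  rw [vol, vol, ← Matrix.det_permute]
  rfl

theorem sign_mul_self {n : ℕ} (σ : Equiv.Perm (Fin n)) :
    ((Equiv.Perm.sign σ : ℤ) : ℝ) * ((Equiv.Perm.sign σ : ℤ) : ℝ) = 1 := by
  rw [← Int.cast_mul, ← Units.val_mul, Int.units_mul_self]
  simp

/-- All permutations in the wedge contribute equally: after reindexing the sum, the sign of the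
permutation meets the sign produced by the skewness of `W`. -/
theorem sum_wedge_mul {k l : ℕ} (α : Lam k) (β : Lam l) {W : (Fin (k + l) → V) → ℝ}
    (hW : IsSkew W) :
    ∑ I : Fin (k + l) → Fin 7, wedge α β (fun a => e (I a)) * W (fun a => e (I a)) =
      ((k.factorial * l.factorial : ℕ) : ℝ)⁻¹ * ((k + l).factorial *
        ∑ I : Fin (k + l) → Fin 7, α (fun a => e (I (Fin.castAdd l a))) *
          β (fun a => e (I (Fin.natAdd k a))) * W (fun a => e (I a))) := by
  simp only [wedge_apply, mul_assoc, ← Finset.mul_sum]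
  congr 1
  simp only [Finset.sum_mul]
  rw [Finset.sum_comm]
  have key : ∀ σ : Equiv.Perm (Fin (k + l)), ∑ I : Fin (k + l) → Fin 7,
      ((Equiv.Perm.sign σ : ℤ) : ℝ) * (α (fun i => e (I (σ (Fin.castAdd l i)))) *
        β (fun j => e (I (σ (Fin.natAdd k j))))) * W (fun a => e (I a)) =
      ∑ I : Fin (k + l) → Fin 7, α (fun a => e (I (Fin.castAdd l a))) *
          (β (fun a => e (I (Fin.natAdd k a))) * W (fun a => e (I a))) := fun σ => by
    rw [← Equiv.sum_comp (Equiv.arrowCongr σ (Equiv.refl (Fin 7)))]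
    refine Finset.sum_congr rfl fun I _ => ?_
    have h := hW σ.symm (fun a => e (I a))
    simp only [Equiv.Perm.sign_symm] at h
    simp only [Equiv.arrowCongr_apply, Function.comp_apply, Equiv.symm_apply_apply,
      Equiv.refl_apply]
    have h' : W (fun a => e (I (σ.symm a))) =
      ((Equiv.Perm.sign σ : ℤ) : ℝ) * W (fun a => e (I a)) := h
    rw [h']
    linear_combination (α (fun a => e (I (Fin.castAdd l a))) *
      (β (fun a => e (I (Fin.natAdd k a))) * W (fun a => e (I a)))) * sign_mul_self σ
  rw [Finset.sum_congr rfl fun σ _ => key σ]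
  rw [Finset.sum_const, Finset.card_univ, Fintype.card_perm, Fintype.card_fin, nsmul_eq_mul]

theorem sum_append {k l : ℕ} (F : (Fin (k + l) → Fin 7) → ℝ) :
    ∑ I, F I = ∑ I : Fin k → Fin 7, ∑ J : Fin l → Fin 7, F (Fin.append I J) := by
  rw [← Equiv.sum_comp (Fin.appendEquiv k l), Fintype.sum_prod_type]
  rfl

theorem e_append {k l : ℕ} (I : Fin k → Fin 7) (J : Fin l → Fin 7) :
    (fun a => e (Fin.append I J a)) = Fin.append (fun a => e (I a)) (fun a => e (J a)) := by
  funext a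
  induction a using Fin.addCases <;> simp

/-- Wedging is adjoint to contraction. With `W` a partially evaluated volume form this computes the
Hodge star of a product without expanding the product. -/
theorem pairing_wedge {k l : ℕ} (α : Lam k) (β : Lam l) {W : (Fin (k + l) → V) → ℝ}
    (hW : IsSkew W) :
    pairing (wedge α β) W =
      pairing α (fun u => pairing β (fun w => W (Fin.append u w))) := by
  have h0 : ((k + l).factorial : ℝ) ≠ 0 := by positivity
  simp only [pairing]
  rw [sum_wedge_mul α β hW, sum_append]
  simp only [Fin.append_left, Fin.append_right, e_append, Finset.mul_sum]
  refine Finset.sum_congr rfl fun I _ => Finset.sum_congr rfl fun J _ => ?_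
  push_cast
  field_simp

theorem star_apply {k l : ℕ} (h : k + l = 7) (α : Lam k) (v : Fin l → V) :
    star h α v = pairing α (fun u => vol (fun b => Fin.append u v (Fin.cast h.symm b))) := rfl

theorem pairing_add {k : ℕ} (α β W : (Fin k → V) → ℝ) :
    pairing (α + β) W = pairing α W + pairing β W := by
  simp [pairing, add_mul, Finset.sum_add_distrib, mul_add]

theorem pairing_sub {k : ℕ} (α β W : (Fin k → V) → ℝ) :
    pairing (α - β) W = pairing α W - pairing β W := by
  simp [pairing, sub_mul, Finset.sum_sub_distrib, mul_sub]

theorem pairing_comm {k : ℕ} (α W : (Fin k → V) → ℝ) : pairing α W = pairing W α := by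
  simp [pairing, mul_comm]

/-! ### Minors and the coordinate expressions of `φ₀` and `*φ₀`. -/

/-- The minor of the columns `f 0, …, f (k - 1)`: the value of `e^{f 0} ∧ ⋯ ∧ e^{f (k - 1)}`. -/
def minor {k : ℕ} (f : Fin k → Fin 7) (v : Fin k → V) : ℝ :=
  Matrix.det (Matrix.of fun a b => v a (f b))

/-- By the Leibniz formula a minor on basis vectors is a signed count of the `σ` with `I = f ∘ σ`.
Skewness of `W` turns each of the `k!` permutations into the same value, and `k!` is the
normalisation of `pairing`. -/
theorem pairing_minor {k : ℕ} (f : Fin k → Fin 7) {W : (Fin k → V) → ℝ} (hW : IsSkew W) :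
    pairing (minor f) W = W (fun a => e (f a)) := by
  have h0 : (k.factorial : ℝ) ≠ 0 := by positivity
  rw [pairing, inv_mul_eq_iff_eq_mul₀ h0]
  have key : ∀ I : Fin k → Fin 7, minor f (fun a => e (I a)) =
      ∑ σ : Equiv.Perm (Fin k), ((Equiv.Perm.sign σ : ℤ) : ℝ) * if I = f ∘ σ then 1 else 0 := by
    intro I
    rw [minor, ← Matrix.det_transpose, Matrix.det_apply']
    refine Finset.sum_congr rfl fun σ _ => ?_
    congr 1
    have : ∀ a, (Matrix.of fun a b => (e (I a)) (f b)).transpose (σ a) a =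
        if I a = f (σ a) then (1 : ℝ) else 0 := fun a => by
      simp [e, eq_comm]
    simp only [this, Finset.prod_ite_zero, Finset.prod_const_one, funext_iff, Function.comp_apply,
      Finset.mem_univ, true_implies]
  simp only [key, Finset.sum_mul]
  rw [Finset.sum_comm]
  have h2 : ∀ σ : Equiv.Perm (Fin k), ∑ I : Fin k → Fin 7, ((Equiv.Perm.sign σ : ℤ) : ℝ) *
      (if I = f ∘ σ then 1 else 0) * W (fun a => e (I a)) = W (fun a => e (f a)) := fun σ => by
    rw [Finset.sum_eq_single (f ∘ σ)]
    · have := hW σ (fun a => e (f a))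
      simp only [if_true, mul_one]
      change _ * W ((fun a => e (f a)) ∘ σ) = _
      rw [this, ← mul_assoc, sign_mul_self, one_mul]
    · intro I _ hI
      simp [hI]
    · simp
  rw [Finset.sum_congr rfl fun σ _ => h2 σ]
  simp [Fintype.card_perm]

theorem pairing_dual (i : Fin 7) (W : (Fin 1 → V) → ℝ) :
    pairing (dual i) W = W (fun _ => e i) := by
  rw [pairing]
  have hI : ∀ I : Fin 1 → Fin 7, (dual i (fun a => e (I a))) = if I = fun _ => i then 1 else 0 := by
    intro I
    simp only [dual, ContinuousAlternatingMap.ofSubsingleton_apply_apply, e, funext_iff]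
    simp [eq_comm]
  simp [hI]

/-- A permutation of the first `k` slots extends by the identity to all slots with the same sign;
this makes contractions of `vol` admissible in `pairing_wedge` and `pairing_minor`. -/
theorem isSkew_append_left {k l : ℕ} {W : (Fin (k + l) → V) → ℝ} (hW : IsSkew W)
    (u : Fin l → V) : IsSkew fun w => W (Fin.append w u) := fun σ v => by
  have := hW (finSumFinEquiv.permCongr (Equiv.Perm.sumCongr σ 1)) (Fin.append v u)
  rw [Equiv.Perm.sign_permCongr, Equiv.Perm.sign_sumCongr, Equiv.Perm.sign_one, mul_one] at this
  rw [← this]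
  refine congrArg W (funext fun a => ?_)
  induction a using Fin.addCases <;> simp

theorem minor_three (f : Fin 3 → Fin 7) (v : Fin 3 → V) :
    minor f v = v 0 (f 0) * (v 1 (f 1) * v 2 (f 2) - v 1 (f 2) * v 2 (f 1)) -
      v 0 (f 1) * (v 1 (f 0) * v 2 (f 2) - v 1 (f 2) * v 2 (f 0)) +
      v 0 (f 2) * (v 1 (f 0) * v 2 (f 1) - v 1 (f 1) * v 2 (f 0)) := by
  simp [minor, Matrix.det_fin_three]
  ring

theorem minor_four (f : Fin 4 → Fin 7) (v : Fin 4 → V) :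
    minor f v = v 0 (f 0) * minor ![f 1, f 2, f 3] ![v 1, v 2, v 3] -
      v 0 (f 1) * minor ![f 0, f 2, f 3] ![v 1, v 2, v 3] +
      v 0 (f 2) * minor ![f 0, f 1, f 3] ![v 1, v 2, v 3] -
      v 0 (f 3) * minor ![f 0, f 1, f 2] ![v 1, v 2, v 3] := by
  simp only [minor_three]
  simp [minor, Matrix.det_succ_row_zero (n := 3), Matrix.det_fin_three, Fin.sum_univ_four,
    Fin.succAbove]
  ring

theorem dual_apply (i : Fin 7) (v : Fin 1 → V) : dual i v = v 0 i := by
  simp [dual, ContinuousAlternatingMap.ofSubsingleton_apply_apply]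

theorem wedge_one_one (α β : Lam 1) (v : Fin 2 → V) :
    wedge α β v = α ![v 0] * β ![v 1] - α ![v 1] * β ![v 0] := by
  have h : ∀ w : Fin 1 → V, w = ![w 0] := fun w => by ext i; fin_cases i; rfl
  have hu : (Finset.univ : Finset (Equiv.Perm (Fin (1 + 1)))) = {1, Equiv.swap 0 1} := by decide
  rw [wedge_apply, hu, Finset.sum_pair (by decide)]
  rw [h fun i => v ((1 : Equiv.Perm (Fin (1 + 1))) (Fin.castAdd 1 i)),
    h fun i => v ((1 : Equiv.Perm (Fin (1 + 1))) (Fin.natAdd 1 i)),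
    h fun i => v ((Equiv.swap 0 1 : Equiv.Perm (Fin (1 + 1))) (Fin.castAdd 1 i)),
    h fun i => v ((Equiv.swap 0 1 : Equiv.Perm (Fin (1 + 1))) (Fin.natAdd 1 i))]
  have h1 : Equiv.Perm.sign (Equiv.swap 0 1 : Equiv.Perm (Fin (1 + 1))) = -1 := by decide
  rw [h1]
  simp [sub_eq_add_neg]

theorem wedge_one_two (α : Lam 1) (β : Lam 2) (v : Fin 3 → V) :
    wedge α β v = α ![v 0] * β ![v 1, v 2] - α ![v 1] * β ![v 0, v 2] +
      α ![v 2] * β ![v 0, v 1] := by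
  have ha : ∀ w : Fin 1 → V, α w = α ![w 0] := fun w => by
    congr 1; ext i; fin_cases i; rfl
  have hb : ∀ w : Fin 2 → V, β w = β ![w 0, w 1] := fun w => by
    congr 1; ext i; fin_cases i <;> rfl
  have hs : ∀ x y : V, β ![y, x] = - β ![x, y] := fun x y => by
    have := isSkew_form β (Equiv.swap 0 1) ![x, y]
    rw [Equiv.Perm.sign_swap (by decide), hb] at this
    simpa using this
  have hu : (Finset.univ : Finset (Equiv.Perm (Fin (1 + 2)))) =
    {1, c[0, 1], c[0, 2], c[1, 2], c[0, 1, 2], c[0, 2, 1]} := by decide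
  rw [wedge_apply, hu]
  rw [Finset.sum_insert (by decide), Finset.sum_insert (by decide), Finset.sum_insert (by decide),
    Finset.sum_insert (by decide), Finset.sum_insert (by decide), Finset.sum_singleton]
  have h1 : Equiv.Perm.sign (c[0, 1] : Equiv.Perm (Fin (1 + 2))) = -1 := by decide
  have h2 : Equiv.Perm.sign (c[0, 2] : Equiv.Perm (Fin (1 + 2))) = -1 := by decide
  have h3 : Equiv.Perm.sign (c[1, 2] : Equiv.Perm (Fin (1 + 2))) = -1 := by decide
  have h4 : Equiv.Perm.sign (c[0, 1, 2] : Equiv.Perm (Fin (1 + 2))) = 1 := by decide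
  have h5 : Equiv.Perm.sign (c[0, 2, 1] : Equiv.Perm (Fin (1 + 2))) = 1 := by decide
  have ha' : ∀ σ : Equiv.Perm (Fin (1 + 2)),
    α (fun i => v (σ (Fin.castAdd 2 i))) = α ![v (σ 0)] := fun σ => ha _
  have hb' : ∀ σ : Equiv.Perm (Fin (1 + 2)),
    β (fun i => v (σ (Fin.natAdd 1 i))) = β ![v (σ 1), v (σ 2)] := fun σ => hb _
  rw [ha', ha', ha', ha', ha', ha', hb', hb', hb', hb', hb', hb']
  rw [h1, h2, h3, h4, h5]
  have p10 : (c[0, 1] : Equiv.Perm (Fin (1 + 2))) 0 = 1 := by decide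
  have p11 : (c[0, 1] : Equiv.Perm (Fin (1 + 2))) 1 = 0 := by decide
  have p12 : (c[0, 1] : Equiv.Perm (Fin (1 + 2))) 2 = 2 := by decide
  have p20 : (c[0, 2] : Equiv.Perm (Fin (1 + 2))) 0 = 2 := by decide
  have p21 : (c[0, 2] : Equiv.Perm (Fin (1 + 2))) 1 = 1 := by decide
  have p22 : (c[0, 2] : Equiv.Perm (Fin (1 + 2))) 2 = 0 := by decide
  have p30 : (c[1, 2] : Equiv.Perm (Fin (1 + 2))) 0 = 0 := by decide
  have p31 : (c[1, 2] : Equiv.Perm (Fin (1 + 2))) 1 = 2 := by decide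
  have p32 : (c[1, 2] : Equiv.Perm (Fin (1 + 2))) 2 = 1 := by decide
  have p40 : (c[0, 1, 2] : Equiv.Perm (Fin (1 + 2))) 0 = 1 := by decide
  have p41 : (c[0, 1, 2] : Equiv.Perm (Fin (1 + 2))) 1 = 2 := by decide
  have p42 : (c[0, 1, 2] : Equiv.Perm (Fin (1 + 2))) 2 = 0 := by decide
  have p50 : (c[0, 2, 1] : Equiv.Perm (Fin (1 + 2))) 0 = 2 := by decide
  have p51 : (c[0, 2, 1] : Equiv.Perm (Fin (1 + 2))) 1 = 0 := by decide
  have p52 : (c[0, 2, 1] : Equiv.Perm (Fin (1 + 2))) 2 = 1 := by decide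
  -- Signs and values of the five cycles are now recorded, so the cycles themselves can become
  -- opaque.
  clear hu
  generalize (c[0, 1] : Equiv.Perm (Fin (1 + 2))) = s1 at *
  generalize (c[0, 2] : Equiv.Perm (Fin (1 + 2))) = s2 at *
  generalize (c[1, 2] : Equiv.Perm (Fin (1 + 2))) = s3 at *
  generalize (c[0, 1, 2] : Equiv.Perm (Fin (1 + 2))) = s4 at *
  generalize (c[0, 2, 1] : Equiv.Perm (Fin (1 + 2))) = s5 at *
  rw [p10, p11, p12, p20, p21, p22, p30, p31, p32, p40, p41, p42, p50, p51, p52]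
  simp only [Equiv.Perm.one_apply, Equiv.Perm.sign_one]
  rw [hs (v 0) (v 2), hs (v 0) (v 1), hs (v 1) (v 2)]
  simp [Nat.factorial]
  ring

theorem dual3_eq_minor (i j k : Fin 7) : ⇑(dual3 i j k) = minor ![i, j, k] := by
  funext v
  rw [dual3, wedge_one_two, minor_three]
  simp only [wedge_one_one, dual_apply]
  simp
  ring

theorem phi0_eq_minor : ⇑phi0 = minor ![0, 1, 2] + minor ![0, 3, 4] + minor ![0, 5, 6] +
    minor ![1, 3, 5] - minor ![1, 4, 6] - minor ![2, 3, 6] - minor ![2, 4, 5] := by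
  rw [phi0]
  simp only [ContinuousAlternatingMap.coe_add, ContinuousAlternatingMap.coe_sub, dual3_eq_minor]

theorem pairing_phi0 {W : (Fin 3 → V) → ℝ} (hW : IsSkew W) : pairing phi0 W =
    W ![e 0, e 1, e 2] + W ![e 0, e 3, e 4] + W ![e 0, e 5, e 6] + W ![e 1, e 3, e 5] -
      W ![e 1, e 4, e 6] - W ![e 2, e 3, e 6] - W ![e 2, e 4, e 5] := by
  have h : ∀ i j k, (fun a => e (![i, j, k] a)) = ![e i, e j, e k] := fun i j k => by
    funext a; fin_cases a <;> rfl
  simp only [phi0_eq_minor, pairing_add, pairing_sub, pairing_minor _ hW, h]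

/-- Expansion of a determinant whose first row is a vector of the standard basis. -/
theorem det_of_row_single {n : ℕ} (A : Matrix (Fin (n + 1)) (Fin (n + 1)) ℝ) (i : Fin (n + 1))
    (h : ∀ j, A 0 j = if j = i then 1 else 0) :
    A.det = (-1) ^ (i : ℕ) * (A.submatrix Fin.succ i.succAbove).det := by
  rw [Matrix.det_succ_row_zero, Finset.sum_eq_single i]
  · simp [h]
  · intro j _ hj
    simp [h, hj]
  · simp

/-- Laplace expansion along three successive rows. The numbers `i`, `j`, `k` are positions among the
columns still present, which is why they are composed through `succAbove`; `f` lists the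
complementary columns. -/
theorem vol_append_three (i : Fin 7) (j : Fin 6) (k : Fin 5) (f : Fin 4 → Fin 7)
    (hf : ∀ b, f b = i.succAbove (j.succAbove (k.succAbove b))) (v : Fin 4 → V) :
    vol (Fin.append ![e i, e (i.succAbove j), e (i.succAbove (j.succAbove k))] v) =
      (-1) ^ ((i : ℕ) + j + k) * minor f v := by
  rw [vol, det_of_row_single _ i, det_of_row_single _ j, det_of_row_single _ k, minor,
    pow_add, pow_add, mul_assoc, mul_assoc]
  · congr 4
    ext a b
    simp only [Matrix.submatrix_apply, Matrix.of_apply, hf]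
    fin_cases a <;> rfl
  · intro c
    simp [Fin.append, Fin.addCases, e]
  · intro c
    simp [Fin.append, Fin.addCases, e]
  · intro c
    simp [Fin.append, Fin.addCases, e]

theorem vol_append_four (i : Fin 7) (j : Fin 6) (k : Fin 5) (l : Fin 4) (f : Fin 3 → Fin 7)
    (hf : ∀ b, f b = i.succAbove (j.succAbove (k.succAbove (l.succAbove b)))) (v : Fin 3 → V) :
    vol (Fin.append ![e i, e (i.succAbove j), e (i.succAbove (j.succAbove k)),
      e (i.succAbove (j.succAbove (k.succAbove l)))] v) =
      (-1) ^ ((i : ℕ) + j + k + l) * minor f v := by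
  rw [vol, det_of_row_single _ i, det_of_row_single _ j, det_of_row_single _ k,
    det_of_row_single _ l, minor, pow_add, pow_add, pow_add, mul_assoc, mul_assoc, mul_assoc]
  · congr 5
    ext a b
    simp only [Matrix.submatrix_apply, Matrix.of_apply, hf]
    fin_cases a <;> rfl
  all_goals
    intro c
    simp [Fin.append, Fin.addCases, e]

theorem starPhi0_apply_eq_pairing (v : Fin 4 → V) :
    starPhi0 v = pairing phi0 (fun u => vol (Fin.append u v)) := rfl

theorem starPhi0_eq_minor : ⇑starPhi0 = minor ![3, 4, 5, 6] + minor ![1, 2, 5, 6] +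
    minor ![1, 2, 3, 4] + minor ![0, 2, 4, 6] - minor ![0, 2, 3, 5] - minor ![0, 1, 4, 5] -
    minor ![0, 1, 3, 6] := by
  funext v
  rw [starPhi0_apply_eq_pairing, pairing_phi0 (isSkew_append_left (isSkew_vol) v)]
  -- The numerals are positions among the remaining columns: for instance `0 2 2` encodes the
  -- indices `0, 3, 4`.
  have h0 : vol (Fin.append ![e 0, e 1, e 2] v) = _ :=
    vol_append_three 0 0 0 ![3, 4, 5, 6] (by decide) v
  have h1 : vol (Fin.append ![e 0, e 3, e 4] v) = _ :=
    vol_append_three 0 2 2 ![1, 2, 5, 6] (by decide) v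
  have h2 : vol (Fin.append ![e 0, e 5, e 6] v) = _ :=
    vol_append_three 0 4 4 ![1, 2, 3, 4] (by decide) v
  have h3 : vol (Fin.append ![e 1, e 3, e 5] v) = _ :=
    vol_append_three 1 2 3 ![0, 2, 4, 6] (by decide) v
  have h4 : vol (Fin.append ![e 1, e 4, e 6] v) = _ :=
    vol_append_three 1 3 4 ![0, 2, 3, 5] (by decide) v
  have h5 : vol (Fin.append ![e 2, e 3, e 6] v) = _ :=
    vol_append_three 2 2 4 ![0, 1, 4, 5] (by decide) v
  have h6 : vol (Fin.append ![e 2, e 4, e 5] v) = _ :=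
    vol_append_three 2 3 3 ![0, 1, 3, 6] (by decide) v
  rw [h0, h1, h2, h3, h4, h5, h6]
  norm_num [Pi.add_apply, Pi.sub_apply]

theorem pairing_starPhi0 {W : (Fin 4 → V) → ℝ} (hW : IsSkew W) : pairing starPhi0 W =
    W ![e 3, e 4, e 5, e 6] + W ![e 1, e 2, e 5, e 6] + W ![e 1, e 2, e 3, e 4] +
        W ![e 0, e 2, e 4, e 6] - W ![e 0, e 2, e 3, e 5] - W ![e 0, e 1, e 4, e 5] -
        W ![e 0, e 1, e 3, e 6] := by
  have h : ∀ i j k l, (fun a => e (![i, j, k, l] a)) = ![e i, e j, e k, e l] := fun i j k l => by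
    funext a; fin_cases a <;> rfl
  simp only [starPhi0_eq_minor, pairing_add, pairing_sub, pairing_minor _ hW, h]

/-- This is `**φ₀ = φ₀`; it lets contractions of `*φ₀` against the volume be traded for `φ₀`. -/
theorem star_starPhi0_apply (v : Fin 3 → V) :
    pairing starPhi0 (fun u => vol (Fin.append u v)) = phi0 v := by
  rw [pairing_starPhi0 (isSkew_append_left isSkew_vol v), phi0_eq_minor]
  have h0 : vol (Fin.append ![e 3, e 4, e 5, e 6] v) = _ :=
    vol_append_four 3 3 3 3 ![0, 1, 2] (by decide) v
  have h1 : vol (Fin.append ![e 1, e 2, e 5, e 6] v) = _ :=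
    vol_append_four 1 1 3 3 ![0, 3, 4] (by decide) v
  have h2 : vol (Fin.append ![e 1, e 2, e 3, e 4] v) = _ :=
    vol_append_four 1 1 1 1 ![0, 5, 6] (by decide) v
  have h3 : vol (Fin.append ![e 0, e 2, e 4, e 6] v) = _ :=
    vol_append_four 0 1 2 3 ![1, 3, 5] (by decide) v
  have h4 : vol (Fin.append ![e 0, e 2, e 3, e 5] v) = _ :=
    vol_append_four 0 1 1 2 ![1, 4, 6] (by decide) v
  have h5 : vol (Fin.append ![e 0, e 1, e 4, e 5] v) = _ :=
    vol_append_four 0 0 2 2 ![2, 3, 6] (by decide) v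
  have h6 : vol (Fin.append ![e 0, e 1, e 3, e 6] v) = _ :=
    vol_append_four 0 0 1 3 ![2, 4, 5] (by decide) v
  rw [h0, h1, h2, h3, h4, h5, h6]
  norm_num [Pi.add_apply, Pi.sub_apply]

theorem phi0_apply (x y z : V) : phi0 ![x, y, z] =
    (x 0 * (y 1 * z 2 - y 2 * z 1) - x 1 * (y 0 * z 2 - y 2 * z 0) + x 2 * (y 0 * z 1 -
        y 1 * z 0)) +
    (x 0 * (y 3 * z 4 - y 4 * z 3) - x 3 * (y 0 * z 4 - y 4 * z 0) + x 4 * (y 0 * z 3 -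
        y 3 * z 0)) +
    (x 0 * (y 5 * z 6 - y 6 * z 5) - x 5 * (y 0 * z 6 - y 6 * z 0) + x 6 * (y 0 * z 5 -
        y 5 * z 0)) +
    (x 1 * (y 3 * z 5 - y 5 * z 3) - x 3 * (y 1 * z 5 - y 5 * z 1) + x 5 * (y 1 * z 3 -
        y 3 * z 1)) -
    (x 1 * (y 4 * z 6 - y 6 * z 4) - x 4 * (y 1 * z 6 - y 6 * z 1) + x 6 * (y 1 * z 4 -
        y 4 * z 1)) -
    (x 2 * (y 3 * z 6 - y 6 * z 3) - x 3 * (y 2 * z 6 - y 6 * z 2) + x 6 * (y 2 * z 3 -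
        y 3 * z 2)) -
    (x 2 * (y 4 * z 5 - y 5 * z 4) - x 4 * (y 2 * z 5 - y 5 * z 2) + x 5 * (y 2 * z 4 -
        y 4 * z 2)) := by
  simp only [phi0_eq_minor, Pi.add_apply, Pi.sub_apply, minor_three]
  simp

theorem starPhi0_apply (x y z w : V) : starPhi0 ![x, y, z, w] =
    ( x 3 * (y 4 * (z 5 * w 6 - z 6 * w 5) - y 5 * (z 4 * w 6 - z 6 * w 4) + y 6 * (z 4 * w 5 -
        z 5 * w 4))
    - x 4 * (y 3 * (z 5 * w 6 - z 6 * w 5) - y 5 * (z 3 * w 6 - z 6 * w 3) + y 6 * (z 3 * w 5 -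
        z 5 * w 3))
    + x 5 * (y 3 * (z 4 * w 6 - z 6 * w 4) - y 4 * (z 3 * w 6 - z 6 * w 3) + y 6 * (z 3 * w 4 -
        z 4 * w 3))
    - x 6 * (y 3 * (z 4 * w 5 - z 5 * w 4) - y 4 * (z 3 * w 5 - z 5 * w 3) + y 5 * (z 3 * w 4 -
        z 4 * w 3))
   ) +
    ( x 1 * (y 2 * (z 5 * w 6 - z 6 * w 5) - y 5 * (z 2 * w 6 - z 6 * w 2) + y 6 * (z 2 * w 5 -
        z 5 * w 2))
    - x 2 * (y 1 * (z 5 * w 6 - z 6 * w 5) - y 5 * (z 1 * w 6 - z 6 * w 1) + y 6 * (z 1 * w 5 -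
        z 5 * w 1))
    + x 5 * (y 1 * (z 2 * w 6 - z 6 * w 2) - y 2 * (z 1 * w 6 - z 6 * w 1) + y 6 * (z 1 * w 2 -
        z 2 * w 1))
    - x 6 * (y 1 * (z 2 * w 5 - z 5 * w 2) - y 2 * (z 1 * w 5 - z 5 * w 1) + y 5 * (z 1 * w 2 -
        z 2 * w 1))
   ) +
    ( x 1 * (y 2 * (z 3 * w 4 - z 4 * w 3) - y 3 * (z 2 * w 4 - z 4 * w 2) + y 4 * (z 2 * w 3 -
        z 3 * w 2))
    - x 2 * (y 1 * (z 3 * w 4 - z 4 * w 3) - y 3 * (z 1 * w 4 - z 4 * w 1) + y 4 * (z 1 * w 3 -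
        z 3 * w 1))
    + x 3 * (y 1 * (z 2 * w 4 - z 4 * w 2) - y 2 * (z 1 * w 4 - z 4 * w 1) + y 4 * (z 1 * w 2 -
        z 2 * w 1))
    - x 4 * (y 1 * (z 2 * w 3 - z 3 * w 2) - y 2 * (z 1 * w 3 - z 3 * w 1) + y 3 * (z 1 * w 2 -
        z 2 * w 1))
   ) +
    ( x 0 * (y 2 * (z 4 * w 6 - z 6 * w 4) - y 4 * (z 2 * w 6 - z 6 * w 2) + y 6 * (z 2 * w 4 -
        z 4 * w 2))
    - x 2 * (y 0 * (z 4 * w 6 - z 6 * w 4) - y 4 * (z 0 * w 6 - z 6 * w 0) + y 6 * (z 0 * w 4 -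
        z 4 * w 0))
    + x 4 * (y 0 * (z 2 * w 6 - z 6 * w 2) - y 2 * (z 0 * w 6 - z 6 * w 0) + y 6 * (z 0 * w 2 -
        z 2 * w 0))
    - x 6 * (y 0 * (z 2 * w 4 - z 4 * w 2) - y 2 * (z 0 * w 4 - z 4 * w 0) + y 4 * (z 0 * w 2 -
        z 2 * w 0))
   ) -
    ( x 0 * (y 2 * (z 3 * w 5 - z 5 * w 3) - y 3 * (z 2 * w 5 - z 5 * w 2) + y 5 * (z 2 * w 3 -
        z 3 * w 2))
    - x 2 * (y 0 * (z 3 * w 5 - z 5 * w 3) - y 3 * (z 0 * w 5 - z 5 * w 0) + y 5 * (z 0 * w 3 -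
        z 3 * w 0))
    + x 3 * (y 0 * (z 2 * w 5 - z 5 * w 2) - y 2 * (z 0 * w 5 - z 5 * w 0) + y 5 * (z 0 * w 2 -
        z 2 * w 0))
    - x 5 * (y 0 * (z 2 * w 3 - z 3 * w 2) - y 2 * (z 0 * w 3 - z 3 * w 0) + y 3 * (z 0 * w 2 -
        z 2 * w 0))
   ) -
    ( x 0 * (y 1 * (z 4 * w 5 - z 5 * w 4) - y 4 * (z 1 * w 5 - z 5 * w 1) + y 5 * (z 1 * w 4 -
        z 4 * w 1))
    - x 1 * (y 0 * (z 4 * w 5 - z 5 * w 4) - y 4 * (z 0 * w 5 - z 5 * w 0) + y 5 * (z 0 * w 4 -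
        z 4 * w 0))
    + x 4 * (y 0 * (z 1 * w 5 - z 5 * w 1) - y 1 * (z 0 * w 5 - z 5 * w 0) + y 5 * (z 0 * w 1 -
        z 1 * w 0))
    - x 5 * (y 0 * (z 1 * w 4 - z 4 * w 1) - y 1 * (z 0 * w 4 - z 4 * w 0) + y 4 * (z 0 * w 1 -
        z 1 * w 0))
   ) -
    ( x 0 * (y 1 * (z 3 * w 6 - z 6 * w 3) - y 3 * (z 1 * w 6 - z 6 * w 1) + y 6 * (z 1 * w 3 -
        z 3 * w 1))
    - x 1 * (y 0 * (z 3 * w 6 - z 6 * w 3) - y 3 * (z 0 * w 6 - z 6 * w 0) + y 6 * (z 0 * w 3 -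
        z 3 * w 0))
    + x 3 * (y 0 * (z 1 * w 6 - z 6 * w 1) - y 1 * (z 0 * w 6 - z 6 * w 0) + y 6 * (z 0 * w 1 -
        z 1 * w 0))
    - x 6 * (y 0 * (z 1 * w 3 - z 3 * w 1) - y 1 * (z 0 * w 3 - z 3 * w 0) + y 3 * (z 0 * w 1 -
        z 1 * w 0))
   ) := by
  simp only [starPhi0_eq_minor, Pi.add_apply, Pi.sub_apply, minor_four, minor_three]
  simp

/-! ### Hodge stars of products with `φ₀` and `*φ₀`. -/

theorem vol_comp_perm (σ : Equiv.Perm (Fin 7)) {u w : Fin 7 → V} (h : ∀ a, w a = u (σ a)) :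
    vol w = ((Equiv.Perm.sign σ : ℤ) : ℝ) * vol u := by
  rw [← isSkew_vol]
  congr 1
  exact funext h

theorem eq_vec_three {X : Type*} (w : Fin 3 → X) : w = ![w 0, w 1, w 2] := by
  ext i; fin_cases i <;> rfl

theorem eq_vec_four {X : Type*} (w : Fin 4 → X) : w = ![w 0, w 1, w 2, w 3] := by
  ext i; fin_cases i <;> rfl

/-- Moving `e j` past the four slots of `*φ₀` is an even permutation, so no sign appears. Thus `i(α
∘ β)` is built from the contractions of `φ₀` with the vectors dual to `α` and `β`. -/
theorem star_wedge_dual_starPhi0 (j : Fin 7) (v : Fin 2 → V) :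
    star (l := 2) (by norm_num) (wedge (dual j) starPhi0) v = phi0 ![e j, v 0, v 1] := by
  refine (pairing_wedge _ _ (isSkew_append_left (k := 1 + 4) (l := 2) isSkew_vol v)).trans ?_
  rw [pairing_dual, ← star_starPhi0_apply]
  congr 1
  funext w
  have hs : Equiv.Perm.sign (c[0, 4, 3, 2, 1] : Equiv.Perm (Fin 7)) = 1 := by decide
  have h := vol_comp_perm c[0, 4, 3, 2, 1] (u := Fin.append w ![e j, v 0, v 1])
    (w := Fin.append (Fin.append (fun _ : Fin 1 => e j) w) v) (fun a => by fin_cases a <;> rfl)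
  rw [hs] at h
  simpa using h

theorem star_wedge_starPhi0 (γ : Lam 3) (v : Fin 0 → V) :
    star (l := 0) (by norm_num) (wedge γ starPhi0) v = pairing γ phi0 := by
  refine (pairing_wedge _ _ (isSkew_append_left (k := 3 + 4) (l := 0) isSkew_vol v)).trans ?_
  congr 1
  funext u
  rw [← star_starPhi0_apply]
  congr 1
  funext w
  have hs : Equiv.Perm.sign (c[0, 4, 1, 5, 2, 6, 3] : Equiv.Perm (Fin 7)) = 1 := by decide
  have h := vol_comp_perm c[0, 4, 1, 5, 2, 6, 3] (u := Fin.append w u)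
    (w := Fin.append (Fin.append u w) v) (fun a => by fin_cases a <;> rfl)
  rw [hs] at h
  simpa using h

theorem star_wedge_phi0 (γ : Lam 3) (v : Fin 1 → V) :
    star (l := 1) (by norm_num) (wedge γ phi0) v =
      -pairing γ (fun u => starPhi0 ![u 0, u 1, u 2, v 0]) := by
  refine (pairing_wedge _ _ (isSkew_append_left (k := 3 + 3) (l := 1) isSkew_vol v)).trans ?_
  rw [pairing, pairing, ← mul_neg, ← Finset.sum_neg_distrib]
  congr 1
  refine Finset.sum_congr rfl fun I _ => ?_
  rw [← mul_neg]
  congr 1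
  rw [starPhi0_apply_eq_pairing, pairing, pairing, ← mul_neg, ← Finset.sum_neg_distrib]
  congr 1
  refine Finset.sum_congr rfl fun J _ => ?_
  rw [← mul_neg]
  congr 1
  -- Exchanging two blocks of three vectors is odd; this is the origin of the minus sign.
  have hs : Equiv.Perm.sign (c[0, 3] * c[1, 4] * c[2, 5] : Equiv.Perm (Fin 7)) = -1 := by decide
  have h := vol_comp_perm (c[0, 3] * c[1, 4] * c[2, 5])
    (u := Fin.append (fun a => e (J a)) ![e (I 0), e (I 1), e (I 2), v 0])
    (w := Fin.append (Fin.append (fun a => e (I a)) (fun a => e (J a))) v)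
    (fun a => by fin_cases a <;> rfl)
  rw [hs] at h
  simpa using h

/-! ### The map `i` and the Hodge star of its values. -/

theorem iMap_apply {h : LinearMap.BilinForm ℝ V} (hs : ∀ v w, h v w = h w v) (x y z : V) :
    iMap h ![x, y, z] = 2 * ∑ i, ∑ j, h (e i) (e j) *
      (x i * phi0 ![e j, y, z] - y i * phi0 ![e j, x, z] + z i * phi0 ![e j, x, y]) := by
  have h1 : ∀ i j, (wedge (dual i) (star (l := 2) (by norm_num) (wedge (dual j) starPhi0)) : Lam 3)
      ![x, y, z] =
      x i * phi0 ![e j, y, z] - y i * phi0 ![e j, x, z] + z i * phi0 ![e j, x, y] := fun i j => by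
    rw [wedge_one_two]
    simp only [dual_apply, star_wedge_dual_starPhi0]
    simp
  simp only [iMap, ContinuousAlternatingMap.sum_apply, ContinuousAlternatingMap.smul_apply,
    ContinuousAlternatingMap.add_apply, h1, smul_eq_mul]
  clear h1
  generalize hT : (fun i j => x i * phi0 ![e j, y, z] - y i * phi0 ![e j, x, z] +
    z i * phi0 ![e j, x, y] : Fin 7 → Fin 7 → ℝ) = T
  replace hT : ∀ i j, x i * phi0 ![e j, y, z] - y i * phi0 ![e j, x, z] +
    z i * phi0 ![e j, x, y] = T i j := fun i j => congrFun (congrFun hT i) j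
  simp only [hT]
  simp only [mul_add, Finset.sum_add_distrib]
  rw [two_mul]
  congr 1
  -- The second half of the symmetrised product is the first with `i` and `j` exchanged, so symmetry
  -- of `h` gives the factor `2`.
  rw [Finset.sum_comm]
  refine Finset.sum_congr rfl fun i _ => Finset.sum_congr rfl fun j _ => ?_
  rw [hs]

theorem iMap_add (h k : LinearMap.BilinForm ℝ V) : iMap (h + k) = iMap h + iMap k := by
  simp only [iMap, LinearMap.add_apply, add_smul, Finset.sum_add_distrib]

theorem iMap_smul (c : ℝ) (h : LinearMap.BilinForm ℝ V) : iMap (c • h) = c • iMap h := by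
  simp [iMap, mul_smul, Finset.smul_sum, -smul_add]

/-- The derivation of the volume form induced by `eʲ ⊗ e_i`. -/
theorem sum_vol_update (i j : Fin 7) (u : Fin 7 → V) :
    ∑ s, u s j * vol (Function.update u s (e i)) = if i = j then vol u else 0 := by
  -- The identity is the entry `(i, j)` of `adj(A) A = (det A) 1`: the cofactors are determinants in
  -- which row `s` is replaced by `e i`.
  have h := congrFun (congrFun (Matrix.adjugate_mul (Matrix.of fun a b => u a b)) i) j
  rw [Matrix.mul_apply, Matrix.smul_apply, Matrix.one_apply] at h
  simp only [Matrix.adjugate_apply] at h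
  simp only [smul_eq_mul, mul_ite, mul_one, mul_zero] at h
  rw [vol, ← h]
  refine Finset.sum_congr rfl fun s _ => ?_
  have he : (fun k => e i k) = (Pi.single i 1 : Fin 7 → ℝ) := by
    funext k
    simp [e, Pi.single_apply]
  rw [vol_eq_det_update, mul_comm, he]
  rfl

theorem sum_fun_succ {n : ℕ} (F : (Fin (n + 1) → Fin 7) → ℝ) :
    ∑ I, F I = ∑ a, ∑ J, F (Fin.cons a J) := by
  rw [← Equiv.sum_comp (Fin.consEquiv fun _ => Fin 7), Fintype.sum_prod_type]
  rfl

theorem sum_fun_two (F : (Fin 2 → Fin 7) → ℝ) : ∑ I, F I = ∑ a, ∑ b, F ![a, b] := by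
  simp only [sum_fun_succ]
  simp
  rfl

theorem sum_fun_three (F : (Fin 3 → Fin 7) → ℝ) : ∑ I, F I = ∑ a, ∑ b, ∑ c, F ![a, b, c] := by
  simp only [sum_fun_succ]
  simp
  rfl

theorem vol_append_swap01 (x y z : V) (v : Fin 4 → V) :
    vol (Fin.append ![y, x, z] v) = -vol (Fin.append ![x, y, z] v) := by
  have := isSkew_append_left (k := 3) isSkew_vol v (Equiv.swap 0 1) ![x, y, z]
  rw [Equiv.Perm.sign_swap (by decide)] at this
  have h : (![x, y, z] ∘ Equiv.swap (0 : Fin 3) 1) = ![y, x, z] := by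
    ext a; fin_cases a <;> rfl
  rw [h] at this
  simpa using this

theorem vol_append_swap12 (x y z : V) (v : Fin 4 → V) :
    vol (Fin.append ![x, z, y] v) = -vol (Fin.append ![x, y, z] v) := by
  have := isSkew_append_left (k := 3) isSkew_vol v (Equiv.swap 1 2) ![x, y, z]
  rw [Equiv.Perm.sign_swap (by decide)] at this
  have h : (![x, y, z] ∘ Equiv.swap (1 : Fin 3) 2) = ![x, z, y] := by
    ext a; fin_cases a <;> rfl
  rw [h] at this
  simpa using this

theorem phi0_swap01 (x y z : V) : phi0 ![y, x, z] = -phi0 ![x, y, z] := by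
  simp only [phi0_apply]
  ring

theorem phi0_swap12 (x y z : V) : phi0 ![x, z, y] = -phi0 ![x, y, z] := by
  simp only [phi0_apply]
  ring

theorem update_append_left {k l : ℕ} (u : Fin k → V) (v : Fin l → V) (a : Fin k) (x : V) :
    Function.update (Fin.append u v) (Fin.castAdd l a) x =
      Fin.append (Function.update u a x) v := by
  funext b
  induction b using Fin.addCases with
  | left b => by_cases hb : b = a <;> simp [hb]
  | right b =>
    have : Fin.natAdd k b ≠ Fin.castAdd l a := fun h => by
      have := congrArg Fin.val h
      have := a.isLt
      simp at *
      omega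
    simp [this]

theorem update_append_right {k l : ℕ} (u : Fin k → V) (v : Fin l → V) (a : Fin l) (x : V) :
    Function.update (Fin.append u v) (Fin.natAdd k a) x =
      Fin.append u (Function.update v a x) := by
  funext b
  induction b using Fin.addCases with
  | right b => by_cases hb : b = a <;> simp [hb]
  | left b =>
    have : Fin.castAdd l b ≠ Fin.natAdd k a := fun h => by
      have := congrArg Fin.val h
      have := b.isLt
      simp at *
      omega
    simp [this]

theorem sum_e_mul (j : Fin 7) (F : Fin 7 → ℝ) : ∑ a, (e a) j * F a = F j := by
  simp [e]

theorem e_comp_vec_three (a b c : Fin 7) : (fun k => e (![a, b, c] k)) = ![e a, e b, e c] := by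
  funext k; fin_cases k <;> rfl

/-- The derivation identity `sum_vol_update`, applied to `(e a, e b, e c, v)` and summed against
`φ₀`. The three basis slots contribute equally because `φ₀` and `vol` are both skew, and `3/3! =
1/2!` is the normalisation of the left side. The four slots of `v` give the derivation action on
`*φ₀`. -/
theorem pairing_contraction_vol (i j : Fin 7) (v : Fin 4 → V) :
    pairing (fun w : Fin 2 → V => phi0 ![e j, w 0, w 1])
      (fun w => vol (Fin.append ![e i, w 0, w 1] v)) =
      (if i = j then starPhi0 v else 0) - ∑ k, v k j * starPhi0 (Function.update v k (e i)) := by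
  have h1 : ∀ a b c, (e a) j * vol (Fin.append ![e i, e b, e c] v) +
      (e b) j * vol (Fin.append ![e a, e i, e c] v) +
      (e c) j * vol (Fin.append ![e a, e b, e i] v) +
      ∑ k, v k j * vol (Fin.append ![e a, e b, e c] (Function.update v k (e i))) =
      if i = j then vol (Fin.append ![e a, e b, e c] v) else 0 := fun a b c => by
    rw [← sum_vol_update]
    have h2 := Fin.sum_univ_add (a := 3) (b := 4) fun s : Fin 7 =>
      Fin.append ![e a, e b, e c] v s j *
        vol (Function.update (Fin.append ![e a, e b, e c] v) s (e i))
    rw [h2]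
    have hl : ∀ a' x, vol (Function.update (α := Fin 7) (Fin.append ![e a, e b, e c] v)
        (Fin.castAdd 4 a') x) = vol (Fin.append (Function.update ![e a, e b, e c] a' x) v) :=
      fun a' x => congrArg vol (update_append_left _ _ _ _)
    have hr : ∀ a' x, vol (Function.update (α := Fin 7) (Fin.append ![e a, e b, e c] v)
        (Fin.natAdd 3 a') x) = vol (Fin.append ![e a, e b, e c] (Function.update v a' x)) :=
      fun a' x => congrArg vol (update_append_right _ _ _ _)
    simp only [hl, hr, Fin.append_right, Fin.append_left]
    rw [Fin.sum_univ_three]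
    have u0 : Function.update ![e a, e b, e c] 0 (e i) = ![e i, e b, e c] := by
      ext k; fin_cases k <;> rfl
    have u1 : Function.update ![e a, e b, e c] 1 (e i) = ![e a, e i, e c] := by
      ext k; fin_cases k <;> rfl
    have u2 : Function.update ![e a, e b, e c] 2 (e i) = ![e a, e b, e i] := by
      ext k; fin_cases k <;> rfl
    rw [u0, u1, u2]
    rfl
  have h3 : ∑ a, ∑ b, ∑ c, phi0 ![e a, e b, e c] *
      ((e a) j * vol (Fin.append ![e i, e b, e c] v) +
      (e b) j * vol (Fin.append ![e a, e i, e c] v) +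
      (e c) j * vol (Fin.append ![e a, e b, e i] v) +
      ∑ k, v k j * vol (Fin.append ![e a, e b, e c] (Function.update v k (e i)))) =
      ∑ a, ∑ b, ∑ c, phi0 ![e a, e b, e c] *
        if i = j then vol (Fin.append ![e a, e b, e c] v) else 0 := by
    simp only [h1]
  have hA : ∑ a, ∑ b, ∑ c, phi0 ![e a, e b, e c] *
      ((e a) j * vol (Fin.append ![e i, e b, e c] v)) =
      ∑ b, ∑ c, phi0 ![e j, e b, e c] * vol (Fin.append ![e i, e b, e c] v) := by
    rw [← sum_e_mul j fun a => ∑ b, ∑ c, phi0 ![e a, e b, e c] *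
      vol (Fin.append ![e i, e b, e c] v)]
    simp only [Finset.mul_sum]
    refine Finset.sum_congr rfl fun a _ => Finset.sum_congr rfl fun b _ =>
      Finset.sum_congr rfl fun c _ => ?_
    ring
  have hB : ∑ a, ∑ b, ∑ c, phi0 ![e a, e b, e c] *
      ((e b) j * vol (Fin.append ![e a, e i, e c] v)) =
      ∑ b, ∑ c, phi0 ![e j, e b, e c] * vol (Fin.append ![e i, e b, e c] v) := by
    rw [← hA, Finset.sum_comm]
    refine Finset.sum_congr rfl fun a _ => Finset.sum_congr rfl fun b _ =>
      Finset.sum_congr rfl fun c _ => ?_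
    rw [phi0_swap01, vol_append_swap01]
    ring
  have hC : ∑ a, ∑ b, ∑ c, phi0 ![e a, e b, e c] *
      ((e c) j * vol (Fin.append ![e a, e b, e i] v)) =
      ∑ b, ∑ c, phi0 ![e j, e b, e c] * vol (Fin.append ![e i, e b, e c] v) := by
    rw [← hB]
    refine Finset.sum_congr rfl fun a _ => ?_
    rw [Finset.sum_comm]
    refine Finset.sum_congr rfl fun b _ => Finset.sum_congr rfl fun c _ => ?_
    rw [phi0_swap12, vol_append_swap12]
    ring
  have hD : ∀ w : Fin 4 → V, starPhi0 w =
      (6 : ℝ)⁻¹ * ∑ a, ∑ b, ∑ c, phi0 ![e a, e b, e c] * vol (Fin.append ![e a, e b, e c] w) :=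
    fun w => by
    rw [starPhi0_apply_eq_pairing, pairing, sum_fun_three]
    simp only [e_comp_vec_three]
    norm_num [Nat.factorial]
  have hE : ∑ k, v k j * starPhi0 (Function.update v k (e i)) = (6 : ℝ)⁻¹ *
      ∑ a, ∑ b, ∑ c, phi0 ![e a, e b, e c] *
        ∑ k, v k j * vol (Fin.append ![e a, e b, e c] (Function.update v k (e i))) := by
    simp only [hD, Fin.sum_univ_four, mul_add, Finset.sum_add_distrib]
    simp only [Finset.mul_sum]
    congr 1
    · congr 1
      · congr 1
        all_goals
          refine Finset.sum_congr rfl fun a _ => Finset.sum_congr rfl fun b _ =>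
            Finset.sum_congr rfl fun c _ => ?_
          ring
      · refine Finset.sum_congr rfl fun a _ => Finset.sum_congr rfl fun b _ =>
          Finset.sum_congr rfl fun c _ => ?_
        ring
    · refine Finset.sum_congr rfl fun a _ => Finset.sum_congr rfl fun b _ =>
        Finset.sum_congr rfl fun c _ => ?_
      ring
  simp only [mul_add, Finset.sum_add_distrib] at h3
  rw [hA, hB, hC] at h3
  rw [hE, pairing, sum_fun_two, hD v]
  split_ifs at h3 ⊢ with hij
  · norm_num [Nat.factorial]
    linarith
  · simp only [mul_zero, Finset.sum_const_zero] at h3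
    norm_num [Nat.factorial]
    linarith

/-- `pairing` as a linear functional of the form. -/
def pairingLin {k : ℕ} (W : (Fin k → V) → ℝ) : Lam k →ₗ[ℝ] ℝ where
  toFun α := pairing α W
  map_add' α β := pairing_add α β W
  map_smul' c α := by
    simp only [pairing, ContinuousAlternatingMap.smul_apply, smul_eq_mul, mul_assoc,
      ← Finset.mul_sum, RingHom.id_apply]
    ring

/-- Summation of `pairing_contraction_vol` against the coefficients of `h`: the diagonal term gives
the trace and the rest is the action of `h` on `*φ₀` as a derivation. -/
theorem star_iMap {h : LinearMap.BilinForm ℝ V} (hs : ∀ v w, h v w = h w v) (v : Fin 4 → V) :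
    star (k := 3) (l := 4) (by norm_num) (iMap h) v = 2 * (trace h * starPhi0 v -
      ∑ i, ∑ j, h (e i) (e j) * ∑ k, v k j * starPhi0 (Function.update v k (e i))) := by
  have hP : ∀ i j, pairing
      (wedge (dual i) (star (l := 2) (by norm_num) (wedge (dual j) starPhi0)) : Lam 3)
      (fun u => vol (Fin.append u v)) =
      (if i = j then starPhi0 v else 0) - ∑ k, v k j * starPhi0 (Function.update v k (e i)) := by
    intro i j
    refine (pairing_wedge _ _ (isSkew_append_left (k := 1 + 2) (l := 4) isSkew_vol v)).trans ?_
    have hB : ⇑(star (l := 2) (by norm_num) (wedge (dual j) starPhi0)) =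
      fun w : Fin 2 → V => phi0 ![e j, w 0, w 1] := funext (star_wedge_dual_starPhi0 j)
    have hA : ∀ w : Fin 2 → V, Fin.append (fun _ : Fin 1 => e i) w = ![e i, w 0, w 1] := fun w => by
      funext a
      fin_cases a <;> rfl
    rw [pairing_dual, hB, ← pairing_contraction_vol]
    simp only [hA]
  change pairingLin (fun u => vol (Fin.append u v)) (iMap h) = _
  simp only [iMap, map_sum, map_smul, map_add, smul_eq_mul]
  simp only [pairingLin, LinearMap.coe_mk, AddHom.coe_mk, hP]
  generalize hT : (fun i j => ∑ k, v k j * starPhi0 (Function.update v k (e i)) :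
    Fin 7 → Fin 7 → ℝ) = T
  replace hT : ∀ i j, ∑ k, v k j * starPhi0 (Function.update v k (e i)) = T i j :=
    fun i j => congrFun (congrFun hT i) j
  simp only [hT]
  have h1 : ∑ i, ∑ j, h (e i) (e j) * ((if j = i then starPhi0 v else 0) - T j i) =
      ∑ i, ∑ j, h (e i) (e j) * ((if i = j then starPhi0 v else 0) - T i j) := by
    rw [Finset.sum_comm]
    refine Finset.sum_congr rfl fun i _ => Finset.sum_congr rfl fun j _ => ?_
    rw [hs]
  simp only [mul_add, Finset.sum_add_distrib]
  rw [h1, ← two_mul]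
  simp only [mul_sub, Finset.sum_sub_distrib, trace, Finset.sum_mul]
  simp

/-! ### Traceless symmetric forms are isomorphic to `Λ³₂₇` through `i`. -/

theorem e_apply (i j : Fin 7) : e i j = if j = i then 1 else 0 := by
  simp [e]

theorem iMap_basis {h : LinearMap.BilinForm ℝ V} (hs : ∀ v w, h v w = h w v) (a b c : Fin 7) :
    iMap h ![e a, e b, e c] = 2 * ∑ m, (h (e a) (e m) * phi0 ![e m, e b, e c] -
      h (e b) (e m) * phi0 ![e m, e a, e c] + h (e c) (e m) * phi0 ![e m, e a, e b]) := by
  rw [iMap_apply hs, ← sum_e_mul a fun i => ∑ m, (h (e i) (e m) * phi0 ![e m, e b, e c] -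
      h (e b) (e m) * phi0 ![e m, e a, e c] + h (e c) (e m) * phi0 ![e m, e a, e b])]
  congr 1
  simp only [mul_add, mul_sub, Finset.sum_add_distrib, Finset.sum_sub_distrib, e_apply]
  simp [Finset.sum_ite_eq]

theorem sum_coord (v : V) : ∑ i, v i • e i = v := by
  ext j
  simp [e_apply]

theorem bilin_ext {h k : LinearMap.BilinForm ℝ V} (H : ∀ i j, h (e i) (e j) = k (e i) (e j)) :
    h = k := by
  refine LinearMap.ext fun v => LinearMap.ext fun w => ?_
  rw [← sum_coord v, ← sum_coord w]
  simp [H]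

theorem lam3_ext {α β : Lam 3}
    (H : ∀ i j k, i < j → j < k → α ![e i, e j, e k] = β ![e i, e j, e k]) : α = β := by
  have s01 : ∀ (γ : Lam 3) (x y z : V), γ ![y, x, z] = -γ ![x, y, z] := fun γ x y z => by
    have h := isSkew_form γ (Equiv.swap 0 1) ![x, y, z]
    have h' : (![x, y, z] ∘ Equiv.swap (0 : Fin 3) 1) = ![y, x, z] := by
      ext a; fin_cases a <;> rfl
    rw [Equiv.Perm.sign_swap (by decide), h'] at h
    simpa using h
  have s12 : ∀ (γ : Lam 3) (x y z : V), γ ![x, z, y] = -γ ![x, y, z] := fun γ x y z => by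
    have h := isSkew_form γ (Equiv.swap 1 2) ![x, y, z]
    have h' : (![x, y, z] ∘ Equiv.swap (1 : Fin 3) 2) = ![x, z, y] := by
      ext a; fin_cases a <;> rfl
    rw [Equiv.Perm.sign_swap (by decide), h'] at h
    simpa using h
  apply ContinuousAlternatingMap.toAlternatingMap_injective
  refine (EuclideanSpace.basisFun (Fin 7) ℝ).toBasis.ext_alternating fun v hv => ?_
  have hb : (fun i => (EuclideanSpace.basisFun (Fin 7) ℝ).toBasis (v i)) =
      ![e (v 0), e (v 1), e (v 2)] := by
    rw [eq_vec_three fun i => (EuclideanSpace.basisFun (Fin 7) ℝ).toBasis (v i)]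
    simp [e]
  rw [hb]
  change α _ = β _
  have h01 : v 0 ≠ v 1 := fun h => absurd (hv h) (by decide)
  have h02 : v 0 ≠ v 2 := fun h => absurd (hv h) (by decide)
  have h12 : v 1 ≠ v 2 := fun h => absurd (hv h) (by decide)
  generalize v 0 = a at *
  generalize v 1 = b at *
  generalize v 2 = c at *
  rcases lt_or_gt_of_ne h01 with h1 | h1 <;> rcases lt_or_gt_of_ne h12 with h2 | h2
  · exact H _ _ _ h1 h2
  · rw [s12 α, s12 β]
    rcases lt_or_gt_of_ne h02 with h3 | h3
    · rw [H _ _ _ h3 h2]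
    · rw [s01 α, s01 β, H _ _ _ h3 h1]
  · rw [s01 α, s01 β]
    rcases lt_or_gt_of_ne h02 with h3 | h3
    · rw [H _ _ _ h1 h3]
    · rw [s12 α, s12 β, H _ _ _ h2 h3]
  · rw [s01 α, s01 β, s12 α, s12 β, s01 α, s01 β, H _ _ _ h2 h1]

/-- The bilinear form with a given matrix. -/
def ofMatrix (H : Matrix (Fin 7) (Fin 7) ℝ) : LinearMap.BilinForm ℝ V :=
  LinearMap.mk₂ ℝ (fun v w => ∑ i, ∑ j, H i j * (v i * w j))
    (fun x y z => by simp [add_mul, mul_add, Finset.sum_add_distrib])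
    (fun c x y => by simp [Finset.mul_sum, mul_assoc, mul_left_comm])
    (fun x y z => by simp [mul_add, Finset.sum_add_distrib])
    (fun c x y => by simp [Finset.mul_sum, mul_left_comm])

theorem ofMatrix_e (H : Matrix (Fin 7) (Fin 7) ℝ) (i j : Fin 7) :
    ofMatrix H (e i) (e j) = H i j := by
  simp [ofMatrix, e_apply]

theorem ofMatrix_symm {H : Matrix (Fin 7) (Fin 7) ℝ} (hH : ∀ i j, H i j = H j i) (v w : V) :
    ofMatrix H v w = ofMatrix H w v := by
  simp only [ofMatrix, LinearMap.mk₂_apply]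
  rw [Finset.sum_comm]
  refine Finset.sum_congr rfl fun i _ => Finset.sum_congr rfl fun j _ => ?_
  rw [hH, mul_comm (v j)]

theorem pairing_starPhi0_e (γ : Lam 3) (a : Fin 7) :
    pairing γ (fun u => starPhi0 ![u 0, u 1, u 2, e a]) = (![γ ![e 1, e 3, e 6] +
        γ ![e 1, e 4, e 5] + γ ![e 2, e 3, e 5] - γ ![e 2, e 4, e 6],
    -γ ![e 0, e 3, e 6] - γ ![e 0, e 4, e 5] - γ ![e 2, e 3, e 4] - γ ![e 2, e 5, e 6],
    -γ ![e 0, e 3, e 5] + γ ![e 0, e 4, e 6] + γ ![e 1, e 3, e 4] + γ ![e 1, e 5, e 6],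
    γ ![e 0, e 1, e 6] + γ ![e 0, e 2, e 5] - γ ![e 1, e 2, e 4] - γ ![e 4, e 5, e 6],
    γ ![e 0, e 1, e 5] - γ ![e 0, e 2, e 6] + γ ![e 1, e 2, e 3] + γ ![e 3, e 5, e 6],
    -γ ![e 0, e 1, e 4] - γ ![e 0, e 2, e 3] - γ ![e 1, e 2, e 6] - γ ![e 3, e 4, e 6],
    -γ ![e 0, e 1, e 3] + γ ![e 0, e 2, e 4] + γ ![e 1, e 2, e 5] +
        γ ![e 3, e 4, e 5]] : Fin 7 → ℝ) a := by
  have hm : ∀ i j k, pairing γ (minor ![i, j, k]) = γ ![e i, e j, e k] := fun i j k => by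
    rw [pairing_comm, pairing_minor _ (isSkew_form γ), e_comp_vec_three]
  have hadd : ∀ W W' : (Fin 3 → V) → ℝ, pairing γ (W + W') = pairing γ W + pairing γ W' :=
    fun W W' => by simp only [pairing_comm γ, pairing_add]
  have hneg : ∀ W : (Fin 3 → V) → ℝ, pairing γ (-W) = -pairing γ W := fun W => by simp [pairing]
  fin_cases a
  · have h : (fun u => starPhi0 ![u 0, u 1, u 2, e 0]) =
        minor ![1, 3, 6] + minor ![1, 4, 5] + minor ![2, 3, 5] + -minor ![2, 4, 6] := by
      funext u
      simp only [starPhi0_apply, Pi.add_apply, Pi.neg_apply, minor_three]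
      simp [e_apply]
      try ring
    change pairing γ (fun u => starPhi0 ![u 0, u 1, u 2, e 0]) = _
    rw [h]
    simp only [hadd, hneg, hm]
    simp
    try ring
  · have h : (fun u => starPhi0 ![u 0, u 1, u 2, e 1]) =
        -minor ![0, 3, 6] + -minor ![0, 4, 5] + -minor ![2, 3, 4] + -minor ![2, 5, 6] := by
      funext u
      simp only [starPhi0_apply, Pi.add_apply, Pi.neg_apply, minor_three]
      simp [e_apply]
      try ring
    change pairing γ (fun u => starPhi0 ![u 0, u 1, u 2, e 1]) = _
    rw [h]
    simp only [hadd, hneg, hm]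
    simp
    try ring
  · have h : (fun u => starPhi0 ![u 0, u 1, u 2, e 2]) =
        -minor ![0, 3, 5] + minor ![0, 4, 6] + minor ![1, 3, 4] + minor ![1, 5, 6] := by
      funext u
      simp only [starPhi0_apply, Pi.add_apply, Pi.neg_apply, minor_three]
      simp [e_apply]
      try ring
    change pairing γ (fun u => starPhi0 ![u 0, u 1, u 2, e 2]) = _
    rw [h]
    simp only [hadd, hneg, hm]
    simp
    try ring
  · have h : (fun u => starPhi0 ![u 0, u 1, u 2, e 3]) =
        minor ![0, 1, 6] + minor ![0, 2, 5] + -minor ![1, 2, 4] + -minor ![4, 5, 6] := by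
      funext u
      simp only [starPhi0_apply, Pi.add_apply, Pi.neg_apply, minor_three]
      simp [e_apply]
      try ring
    change pairing γ (fun u => starPhi0 ![u 0, u 1, u 2, e 3]) = _
    rw [h]
    simp only [hadd, hneg, hm]
    simp
    try ring
  · have h : (fun u => starPhi0 ![u 0, u 1, u 2, e 4]) =
        minor ![0, 1, 5] + -minor ![0, 2, 6] + minor ![1, 2, 3] + minor ![3, 5, 6] := by
      funext u
      simp only [starPhi0_apply, Pi.add_apply, Pi.neg_apply, minor_three]
      simp [e_apply]
      try ring
    change pairing γ (fun u => starPhi0 ![u 0, u 1, u 2, e 4]) = _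
    rw [h]
    simp only [hadd, hneg, hm]
    simp
    try ring
  · have h : (fun u => starPhi0 ![u 0, u 1, u 2, e 5]) =
        -minor ![0, 1, 4] + -minor ![0, 2, 3] + -minor ![1, 2, 6] + -minor ![3, 4, 6] := by
      funext u
      simp only [starPhi0_apply, Pi.add_apply, Pi.neg_apply, minor_three]
      simp [e_apply]
      try ring
    change pairing γ (fun u => starPhi0 ![u 0, u 1, u 2, e 5]) = _
    rw [h]
    simp only [hadd, hneg, hm]
    simp
    try ring
  · have h : (fun u => starPhi0 ![u 0, u 1, u 2, e 6]) =
        -minor ![0, 1, 3] + minor ![0, 2, 4] + minor ![1, 2, 5] + minor ![3, 4, 5] := by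
      funext u
      simp only [starPhi0_apply, Pi.add_apply, Pi.neg_apply, minor_three]
      simp [e_apply]
      try ring
    change pairing γ (fun u => starPhi0 ![u 0, u 1, u 2, e 6]) = _
    rw [h]
    simp only [hadd, hneg, hm]
    simp
    try ring

/-- Taking Hodge stars, `γ ∧ *φ₀ = 0` becomes orthogonality to `φ₀` and `γ ∧ φ₀ = 0` becomes
orthogonality to the seven contractions of `*φ₀`. These eight equations cut `Λ³`, of dimension 35,
down to dimension 27. -/
theorem coeff_eqs_of_wedge_eq_zero {γ : Lam 3} (h1 : wedge γ phi0 = 0) (h2 : wedge γ starPhi0 = 0) :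
    γ ![e 0, e 1, e 2] + γ ![e 0, e 3, e 4] + γ ![e 0, e 5, e 6] + γ ![e 1, e 3, e 5] -
        γ ![e 1, e 4, e 6] - γ ![e 2, e 3, e 6] -
        γ ![e 2, e 4, e 5] = 0 ∧ ∀ a, (![γ ![e 1, e 3, e 6] + γ ![e 1, e 4, e 5] +
        γ ![e 2, e 3, e 5] - γ ![e 2, e 4, e 6],
    -γ ![e 0, e 3, e 6] - γ ![e 0, e 4, e 5] - γ ![e 2, e 3, e 4] - γ ![e 2, e 5, e 6],
    -γ ![e 0, e 3, e 5] + γ ![e 0, e 4, e 6] + γ ![e 1, e 3, e 4] + γ ![e 1, e 5, e 6],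
    γ ![e 0, e 1, e 6] + γ ![e 0, e 2, e 5] - γ ![e 1, e 2, e 4] - γ ![e 4, e 5, e 6],
    γ ![e 0, e 1, e 5] - γ ![e 0, e 2, e 6] + γ ![e 1, e 2, e 3] + γ ![e 3, e 5, e 6],
    -γ ![e 0, e 1, e 4] - γ ![e 0, e 2, e 3] - γ ![e 1, e 2, e 6] - γ ![e 3, e 4, e 6],
    -γ ![e 0, e 1, e 3] + γ ![e 0, e 2, e 4] + γ ![e 1, e 2, e 5] +
        γ ![e 3, e 4, e 5]] : Fin 7 → ℝ) a = 0 := by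
  have hz : ∀ {k l : ℕ} (h : k + l = 7) (v : Fin l → V), star h (0 : Lam k) v = 0 := fun h v => by
    simp [star_apply, pairing]
  constructor
  · rw [← pairing_phi0 (isSkew_form γ), pairing_comm, ← star_wedge_starPhi0 γ Fin.elim0, h2, hz]
  · intro a
    have h := star_wedge_phi0 γ fun _ => e a
    rw [h1, hz] at h
    rw [← pairing_starPhi0_e]
    linarith

/-- The value of `iMap h` on `(e i, e j, e k)`, `i < j < k`, in terms of the coefficients of `h`. -/
def iMapCoeff (h : Fin 7 → Fin 7 → ℝ) : Fin 7 → Fin 7 → Fin 7 → ℝ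
  | 0, 1, 2 => 2 * h 0 0 + 2 * h 1 1 + 2 * h 2 2
  | 0, 1, 3 => 2 * h 0 5 - 2 * h 1 4 + 2 * h 2 3
  | 0, 1, 4 => -2 * h 0 6 + 2 * h 1 3 + 2 * h 2 4
  | 0, 1, 5 => -2 * h 0 3 - 2 * h 1 6 + 2 * h 2 5
  | 0, 1, 6 => 2 * h 0 4 + 2 * h 1 5 + 2 * h 2 6
  | 0, 2, 3 => -2 * h 0 6 - 2 * h 1 3 - 2 * h 2 4
  | 0, 2, 4 => -2 * h 0 5 - 2 * h 1 4 + 2 * h 2 3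
  | 0, 2, 5 => 2 * h 0 4 - 2 * h 1 5 - 2 * h 2 6
  | 0, 2, 6 => 2 * h 0 3 - 2 * h 1 6 + 2 * h 2 5
  | 0, 3, 4 => 2 * h 0 0 + 2 * h 3 3 + 2 * h 4 4
  | 0, 3, 5 => 2 * h 0 1 - 2 * h 3 6 + 2 * h 4 5
  | 0, 3, 6 => -2 * h 0 2 + 2 * h 3 5 + 2 * h 4 6
  | 0, 4, 5 => -2 * h 0 2 - 2 * h 3 5 - 2 * h 4 6
  | 0, 4, 6 => -2 * h 0 1 - 2 * h 3 6 + 2 * h 4 5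
  | 0, 5, 6 => 2 * h 0 0 + 2 * h 5 5 + 2 * h 6 6
  | 1, 2, 3 => 2 * h 0 3 - 2 * h 1 6 - 2 * h 2 5
  | 1, 2, 4 => 2 * h 0 4 - 2 * h 1 5 + 2 * h 2 6
  | 1, 2, 5 => 2 * h 0 5 + 2 * h 1 4 + 2 * h 2 3
  | 1, 2, 6 => 2 * h 0 6 + 2 * h 1 3 - 2 * h 2 4
  | 1, 3, 4 => 2 * h 0 1 + 2 * h 3 6 + 2 * h 4 5
  | 1, 3, 5 => 2 * h 1 1 + 2 * h 3 3 + 2 * h 5 5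
  | 1, 3, 6 => -2 * h 1 2 - 2 * h 3 4 + 2 * h 5 6
  | 1, 4, 5 => -2 * h 1 2 + 2 * h 3 4 - 2 * h 5 6
  | 1, 4, 6 => -2 * h 1 1 - 2 * h 4 4 - 2 * h 6 6
  | 1, 5, 6 => 2 * h 0 1 - 2 * h 3 6 - 2 * h 4 5
  | 2, 3, 4 => 2 * h 0 2 + 2 * h 3 5 - 2 * h 4 6
  | 2, 3, 5 => 2 * h 1 2 - 2 * h 3 4 - 2 * h 5 6
  | 2, 3, 6 => -2 * h 2 2 - 2 * h 3 3 - 2 * h 6 6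
  | 2, 4, 5 => -2 * h 2 2 - 2 * h 4 4 - 2 * h 5 5
  | 2, 4, 6 => -2 * h 1 2 - 2 * h 3 4 - 2 * h 5 6
  | 2, 5, 6 => 2 * h 0 2 - 2 * h 3 5 + 2 * h 4 6
  | 3, 4, 5 => 2 * h 0 5 - 2 * h 1 4 - 2 * h 2 3
  | 3, 4, 6 => 2 * h 0 6 - 2 * h 1 3 + 2 * h 2 4
  | 3, 5, 6 => 2 * h 0 3 + 2 * h 1 6 + 2 * h 2 5
  | 4, 5, 6 => 2 * h 0 4 + 2 * h 1 5 - 2 * h 2 6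
  | _, _, _ => 0

-- The 35 coefficients are compared one by one; the symmetry relations bring every entry of `h` into
-- the upper triangle used by `iMapCoeff`.
set_option maxHeartbeats 4000000 in
theorem iMap_eq_iMapCoeff {h : LinearMap.BilinForm ℝ V} (hs : ∀ v w, h v w = h w v)
    {i j k : Fin 7} (hij : i < j) (hjk : j < k) :
    iMap h ![e i, e j, e k] = iMapCoeff (fun a b => h (e a) (e b)) i j k := by
  rw [iMap_basis hs]
  simp only [phi0_apply, Fin.sum_univ_seven]
  have h01 := hs (e 1) (e 0)
  have h02 := hs (e 2) (e 0)
  have h03 := hs (e 3) (e 0)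
  have h04 := hs (e 4) (e 0)
  have h05 := hs (e 5) (e 0)
  have h06 := hs (e 6) (e 0)
  have h12 := hs (e 2) (e 1)
  have h13 := hs (e 3) (e 1)
  have h14 := hs (e 4) (e 1)
  have h15 := hs (e 5) (e 1)
  have h16 := hs (e 6) (e 1)
  have h23 := hs (e 3) (e 2)
  have h24 := hs (e 4) (e 2)
  have h25 := hs (e 5) (e 2)
  have h26 := hs (e 6) (e 2)
  have h34 := hs (e 4) (e 3)
  have h35 := hs (e 5) (e 3)
  have h36 := hs (e 6) (e 3)
  have h45 := hs (e 5) (e 4)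
  have h46 := hs (e 6) (e 4)
  have h56 := hs (e 6) (e 5)
  fin_cases i <;> fin_cases j <;> first | exact absurd hij (by decide) | skip
  all_goals fin_cases k <;> first | exact absurd hjk (by decide) | skip
  all_goals
    simp [e_apply, iMapCoeff, *]
    try ring

/-- The matrix of `iMap⁻¹ γ`, in terms of the coefficients of `γ`. -/
def preimageMatrix (g : Fin 7 → Fin 7 → Fin 7 → ℝ) : Matrix (Fin 7) (Fin 7) ℝ :=
  !![(4 * g 0 1 2 + 4 * g 0 3 4 + 4 * g 0 5 6) / 16, (2 * g 0 3 5 - 2 * g 0 4 6 + 2 * g 1 3 4 +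
      2 * g 1 5 6) / 16, (-2 * g 0 3 6 - 2 * g 0 4 5 + 2 * g 2 3 4 +
      2 * g 2 5 6) / 16, (-2 * g 0 1 5 + 2 * g 0 2 6 + 2 * g 1 2 3 +
      2 * g 3 5 6) / 16, (2 * g 0 1 6 + 2 * g 0 2 5 + 2 * g 1 2 4 +
      2 * g 4 5 6) / 16, (2 * g 0 1 3 - 2 * g 0 2 4 + 2 * g 1 2 5 +
      2 * g 3 4 5) / 16, (-2 * g 0 1 4 - 2 * g 0 2 3 + 2 * g 1 2 6 + 2 * g 3 4 6) / 16;
    (2 * g 0 3 5 - 2 * g 0 4 6 + 2 * g 1 3 4 + 2 * g 1 5 6) / 16, (4 * g 0 1 2 + 4 * g 1 3 5 -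
        4 * g 1 4 6) / 16, (-2 * g 1 3 6 - 2 * g 1 4 5 + 2 * g 2 3 5 -
        2 * g 2 4 6) / 16, (2 * g 0 1 4 - 2 * g 0 2 3 + 2 * g 1 2 6 -
        2 * g 3 4 6) / 16, (-2 * g 0 1 3 - 2 * g 0 2 4 + 2 * g 1 2 5 -
        2 * g 3 4 5) / 16, (2 * g 0 1 6 - 2 * g 0 2 5 - 2 * g 1 2 4 +
        2 * g 4 5 6) / 16, (-2 * g 0 1 5 - 2 * g 0 2 6 - 2 * g 1 2 3 + 2 * g 3 5 6) / 16;
    (-2 * g 0 3 6 - 2 * g 0 4 5 + 2 * g 2 3 4 + 2 * g 2 5 6) / 16, (-2 * g 1 3 6 - 2 * g 1 4 5 +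
        2 * g 2 3 5 - 2 * g 2 4 6) / 16, (4 * g 0 1 2 - 4 * g 2 3 6 -
        4 * g 2 4 5) / 16, (2 * g 0 1 3 + 2 * g 0 2 4 + 2 * g 1 2 5 -
        2 * g 3 4 5) / 16, (2 * g 0 1 4 - 2 * g 0 2 3 - 2 * g 1 2 6 +
        2 * g 3 4 6) / 16, (2 * g 0 1 5 + 2 * g 0 2 6 - 2 * g 1 2 3 +
        2 * g 3 5 6) / 16, (2 * g 0 1 6 - 2 * g 0 2 5 + 2 * g 1 2 4 - 2 * g 4 5 6) / 16;
    (-2 * g 0 1 5 + 2 * g 0 2 6 + 2 * g 1 2 3 + 2 * g 3 5 6) / 16, (2 * g 0 1 4 - 2 * g 0 2 3 +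
        2 * g 1 2 6 - 2 * g 3 4 6) / 16, (2 * g 0 1 3 + 2 * g 0 2 4 + 2 * g 1 2 5 -
        2 * g 3 4 5) / 16, (4 * g 0 3 4 + 4 * g 1 3 5 - 4 * g 2 3 6) / 16, (-2 * g 1 3 6 +
        2 * g 1 4 5 - 2 * g 2 3 5 - 2 * g 2 4 6) / 16, (2 * g 0 3 6 - 2 * g 0 4 5 + 2 * g 2 3 4 -
        2 * g 2 5 6) / 16, (-2 * g 0 3 5 - 2 * g 0 4 6 + 2 * g 1 3 4 - 2 * g 1 5 6) / 16;
    (2 * g 0 1 6 + 2 * g 0 2 5 + 2 * g 1 2 4 + 2 * g 4 5 6) / 16, (-2 * g 0 1 3 - 2 * g 0 2 4 +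
        2 * g 1 2 5 - 2 * g 3 4 5) / 16, (2 * g 0 1 4 - 2 * g 0 2 3 - 2 * g 1 2 6 +
        2 * g 3 4 6) / 16, (-2 * g 1 3 6 + 2 * g 1 4 5 - 2 * g 2 3 5 -
        2 * g 2 4 6) / 16, (4 * g 0 3 4 - 4 * g 1 4 6 - 4 * g 2 4 5) / 16, (2 * g 0 3 5 +
        2 * g 0 4 6 + 2 * g 1 3 4 - 2 * g 1 5 6) / 16, (2 * g 0 3 6 - 2 * g 0 4 5 - 2 * g 2 3 4 +
        2 * g 2 5 6) / 16;
    (2 * g 0 1 3 - 2 * g 0 2 4 + 2 * g 1 2 5 + 2 * g 3 4 5) / 16, (2 * g 0 1 6 - 2 * g 0 2 5 -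
        2 * g 1 2 4 + 2 * g 4 5 6) / 16, (2 * g 0 1 5 + 2 * g 0 2 6 - 2 * g 1 2 3 +
        2 * g 3 5 6) / 16, (2 * g 0 3 6 - 2 * g 0 4 5 + 2 * g 2 3 4 -
        2 * g 2 5 6) / 16, (2 * g 0 3 5 + 2 * g 0 4 6 + 2 * g 1 3 4 -
        2 * g 1 5 6) / 16, (4 * g 0 5 6 + 4 * g 1 3 5 - 4 * g 2 4 5) / 16, (2 * g 1 3 6 -
        2 * g 1 4 5 - 2 * g 2 3 5 - 2 * g 2 4 6) / 16;
    (-2 * g 0 1 4 - 2 * g 0 2 3 + 2 * g 1 2 6 + 2 * g 3 4 6) / 16, (-2 * g 0 1 5 - 2 * g 0 2 6 -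
        2 * g 1 2 3 + 2 * g 3 5 6) / 16, (2 * g 0 1 6 - 2 * g 0 2 5 + 2 * g 1 2 4 -
        2 * g 4 5 6) / 16, (-2 * g 0 3 5 - 2 * g 0 4 6 + 2 * g 1 3 4 -
        2 * g 1 5 6) / 16, (2 * g 0 3 6 - 2 * g 0 4 5 - 2 * g 2 3 4 +
        2 * g 2 5 6) / 16, (2 * g 1 3 6 - 2 * g 1 4 5 - 2 * g 2 3 5 -
        2 * g 2 4 6) / 16, (4 * g 0 5 6 - 4 * g 1 4 6 - 4 * g 2 3 6) / 16]

-- On traceless forms `i` multiplies squared norms by `8`, so its inverse on `Λ³₂₇` is its transpose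
-- divided by `8`; `preimageMatrix` is this transpose written out. The eight equations of `Λ³₂₇` are
-- what makes it a right inverse.
set_option maxHeartbeats 4000000 in
theorem exists_iMap_eq {γ : Lam 3} (h1 : wedge γ phi0 = 0) (h2 : wedge γ starPhi0 = 0) :
    ∃ h : LinearMap.BilinForm ℝ V, (∀ v w, h v w = h w v) ∧ trace h = 0 ∧ iMap h = γ := by
  obtain ⟨k, hk⟩ := coeff_eqs_of_wedge_eq_zero h1 h2
  obtain ⟨g, hg⟩ : ∃ g : Fin 7 → Fin 7 → Fin 7 → ℝ, ∀ a b c, γ ![e a, e b, e c] = g a b c :=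
    ⟨fun a b c => γ ![e a, e b, e c], fun _ _ _ => rfl⟩
  have k0 := hk 0
  have k1 := hk 1
  have k2 := hk 2
  have k3 := hk 3
  have k4 := hk 4
  have k5 := hk 5
  have k6 := hk 6
  simp only [hg] at k k0 k1 k2 k3 k4 k5 k6
  simp only [Matrix.cons_val] at k0 k1 k2 k3 k4 k5 k6
  have hs : ∀ i j, preimageMatrix g i j = preimageMatrix g j i := fun i j => by
    fin_cases i <;> fin_cases j <;> rfl
  refine ⟨ofMatrix (preimageMatrix g), ofMatrix_symm hs, ?_, ?_⟩
  · simp only [trace, ofMatrix_e, Fin.sum_univ_seven, preimageMatrix, Matrix.of_apply,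
      Matrix.cons_val]
    -- Each of the seven triples of `φ₀` enters three diagonal entries with weight `4/16`, so the
    -- trace is `3/4` of the pairing of `γ` with `φ₀`.
    linear_combination 3/4 * k
  · refine lam3_ext fun i j l hij hjl => ?_
    rw [iMap_eq_iMapCoeff (ofMatrix_symm hs) hij hjl, hg]
    simp only [ofMatrix_e]
    fin_cases i <;> fin_cases j <;> first | exact absurd hij (by decide) | skip
    all_goals fin_cases l <;> first | exact absurd hjl (by decide) | skip
    all_goals
      simp [iMapCoeff, preimageMatrix]
      linarith

theorem eq_zero_of_iMap_eq_zero {h : LinearMap.BilinForm ℝ V} (hs : ∀ v w, h v w = h w v)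
    (ht : trace h = 0) (h0 : iMap h = 0) : h = 0 := by
  obtain ⟨k, hk⟩ : ∃ k : Fin 7 → Fin 7 → ℝ, ∀ i j, h (e i) (e j) = k i j :=
    ⟨fun i j => h (e i) (e j), fun _ _ => rfl⟩
  have E : ∀ i j l, i < j → j < l → iMapCoeff k i j l = 0 := fun i j l hij hjl => by
    have := iMap_eq_iMapCoeff hs hij hjl
    simp only [hk] at this
    rw [← this, h0]
    rfl
  have ks : ∀ i j, k i j = k j i := fun i j => by rw [← hk, hs, hk]
  simp only [trace, hk, Fin.sum_univ_seven] at ht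
  have h012 : 2 * k 0 0 + 2 * k 1 1 + 2 * k 2 2 = 0 :=
    E 0 1 2 (by decide) (by decide)
  have h013 : 2 * k 0 5 - 2 * k 1 4 + 2 * k 2 3 = 0 :=
    E 0 1 3 (by decide) (by decide)
  have h014 : -2 * k 0 6 + 2 * k 1 3 + 2 * k 2 4 = 0 :=
    E 0 1 4 (by decide) (by decide)
  have h015 : -2 * k 0 3 - 2 * k 1 6 + 2 * k 2 5 = 0 :=
    E 0 1 5 (by decide) (by decide)
  have h016 : 2 * k 0 4 + 2 * k 1 5 + 2 * k 2 6 = 0 :=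
    E 0 1 6 (by decide) (by decide)
  have h023 : -2 * k 0 6 - 2 * k 1 3 - 2 * k 2 4 = 0 :=
    E 0 2 3 (by decide) (by decide)
  have h024 : -2 * k 0 5 - 2 * k 1 4 + 2 * k 2 3 = 0 :=
    E 0 2 4 (by decide) (by decide)
  have h025 : 2 * k 0 4 - 2 * k 1 5 - 2 * k 2 6 = 0 :=
    E 0 2 5 (by decide) (by decide)
  have h026 : 2 * k 0 3 - 2 * k 1 6 + 2 * k 2 5 = 0 :=
    E 0 2 6 (by decide) (by decide)
  have h034 : 2 * k 0 0 + 2 * k 3 3 + 2 * k 4 4 = 0 :=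
    E 0 3 4 (by decide) (by decide)
  have h035 : 2 * k 0 1 - 2 * k 3 6 + 2 * k 4 5 = 0 :=
    E 0 3 5 (by decide) (by decide)
  have h036 : -2 * k 0 2 + 2 * k 3 5 + 2 * k 4 6 = 0 :=
    E 0 3 6 (by decide) (by decide)
  have h045 : -2 * k 0 2 - 2 * k 3 5 - 2 * k 4 6 = 0 :=
    E 0 4 5 (by decide) (by decide)
  have h046 : -2 * k 0 1 - 2 * k 3 6 + 2 * k 4 5 = 0 :=
    E 0 4 6 (by decide) (by decide)
  have h056 : 2 * k 0 0 + 2 * k 5 5 + 2 * k 6 6 = 0 :=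
    E 0 5 6 (by decide) (by decide)
  have h123 : 2 * k 0 3 - 2 * k 1 6 - 2 * k 2 5 = 0 :=
    E 1 2 3 (by decide) (by decide)
  have h124 : 2 * k 0 4 - 2 * k 1 5 + 2 * k 2 6 = 0 :=
    E 1 2 4 (by decide) (by decide)
  have h125 : 2 * k 0 5 + 2 * k 1 4 + 2 * k 2 3 = 0 :=
    E 1 2 5 (by decide) (by decide)
  have h126 : 2 * k 0 6 + 2 * k 1 3 - 2 * k 2 4 = 0 :=
    E 1 2 6 (by decide) (by decide)
  have h134 : 2 * k 0 1 + 2 * k 3 6 + 2 * k 4 5 = 0 :=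
    E 1 3 4 (by decide) (by decide)
  have h135 : 2 * k 1 1 + 2 * k 3 3 + 2 * k 5 5 = 0 :=
    E 1 3 5 (by decide) (by decide)
  have h136 : -2 * k 1 2 - 2 * k 3 4 + 2 * k 5 6 = 0 :=
    E 1 3 6 (by decide) (by decide)
  have h145 : -2 * k 1 2 + 2 * k 3 4 - 2 * k 5 6 = 0 :=
    E 1 4 5 (by decide) (by decide)
  have h146 : -2 * k 1 1 - 2 * k 4 4 - 2 * k 6 6 = 0 :=
    E 1 4 6 (by decide) (by decide)
  have h156 : 2 * k 0 1 - 2 * k 3 6 - 2 * k 4 5 = 0 :=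
    E 1 5 6 (by decide) (by decide)
  have h234 : 2 * k 0 2 + 2 * k 3 5 - 2 * k 4 6 = 0 :=
    E 2 3 4 (by decide) (by decide)
  have h235 : 2 * k 1 2 - 2 * k 3 4 - 2 * k 5 6 = 0 :=
    E 2 3 5 (by decide) (by decide)
  have h236 : -2 * k 2 2 - 2 * k 3 3 - 2 * k 6 6 = 0 :=
    E 2 3 6 (by decide) (by decide)
  have h245 : -2 * k 2 2 - 2 * k 4 4 - 2 * k 5 5 = 0 :=
    E 2 4 5 (by decide) (by decide)
  have h246 : -2 * k 1 2 - 2 * k 3 4 - 2 * k 5 6 = 0 :=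
    E 2 4 6 (by decide) (by decide)
  have h256 : 2 * k 0 2 - 2 * k 3 5 + 2 * k 4 6 = 0 :=
    E 2 5 6 (by decide) (by decide)
  have h345 : 2 * k 0 5 - 2 * k 1 4 - 2 * k 2 3 = 0 :=
    E 3 4 5 (by decide) (by decide)
  have h346 : 2 * k 0 6 - 2 * k 1 3 + 2 * k 2 4 = 0 :=
    E 3 4 6 (by decide) (by decide)
  have h356 : 2 * k 0 3 + 2 * k 1 6 + 2 * k 2 5 = 0 :=
    E 3 5 6 (by decide) (by decide)
  have h456 : 2 * k 0 4 + 2 * k 1 5 - 2 * k 2 6 = 0 :=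
    E 4 5 6 (by decide) (by decide)
  -- The three triples of `φ₀` through an index sum, up to sign, to `4 k i i + 2 tr k`. An
  -- off-diagonal entry occurs with coefficient `±2` in four equations, whose signed sum isolates it
  -- with factor `8`.
  have K : ∀ i j, i ≤ j → k i j = 0 := fun i j hij => by
    fin_cases i <;> fin_cases j <;> first | exact absurd hij (by decide) | skip
    · change k 0 0 = 0
      linear_combination 1/4 * h012 + 1/4 * h034 + 1/4 * h056 - 1/2 * ht
    · change k 0 1 = 0
      linear_combination 1/8 * h035 - 1/8 * h046 + 1/8 * h134 + 1/8 * h156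
    · change k 0 2 = 0
      linear_combination -1/8 * h036 - 1/8 * h045 + 1/8 * h234 + 1/8 * h256
    · change k 0 3 = 0
      linear_combination -1/8 * h015 + 1/8 * h026 + 1/8 * h123 + 1/8 * h356
    · change k 0 4 = 0
      linear_combination 1/8 * h016 + 1/8 * h025 + 1/8 * h124 + 1/8 * h456
    · change k 0 5 = 0
      linear_combination 1/8 * h013 - 1/8 * h024 + 1/8 * h125 + 1/8 * h345
    · change k 0 6 = 0
      linear_combination -1/8 * h014 - 1/8 * h023 + 1/8 * h126 + 1/8 * h346
    · change k 1 1 = 0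
      linear_combination 1/4 * h012 + 1/4 * h135 - 1/4 * h146 - 1/2 * ht
    · change k 1 2 = 0
      linear_combination -1/8 * h136 - 1/8 * h145 + 1/8 * h235 - 1/8 * h246
    · change k 1 3 = 0
      linear_combination 1/8 * h014 - 1/8 * h023 + 1/8 * h126 - 1/8 * h346
    · change k 1 4 = 0
      linear_combination -1/8 * h013 - 1/8 * h024 + 1/8 * h125 - 1/8 * h345
    · change k 1 5 = 0
      linear_combination 1/8 * h016 - 1/8 * h025 - 1/8 * h124 + 1/8 * h456
    · change k 1 6 = 0
      linear_combination -1/8 * h015 - 1/8 * h026 - 1/8 * h123 + 1/8 * h356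
    · change k 2 2 = 0
      linear_combination 1/4 * h012 - 1/4 * h236 - 1/4 * h245 - 1/2 * ht
    · change k 2 3 = 0
      linear_combination 1/8 * h013 + 1/8 * h024 + 1/8 * h125 - 1/8 * h345
    · change k 2 4 = 0
      linear_combination 1/8 * h014 - 1/8 * h023 - 1/8 * h126 + 1/8 * h346
    · change k 2 5 = 0
      linear_combination 1/8 * h015 + 1/8 * h026 - 1/8 * h123 + 1/8 * h356
    · change k 2 6 = 0
      linear_combination 1/8 * h016 - 1/8 * h025 + 1/8 * h124 - 1/8 * h456
    · change k 3 3 = 0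
      linear_combination 1/4 * h034 + 1/4 * h135 - 1/4 * h236 - 1/2 * ht
    · change k 3 4 = 0
      linear_combination -1/8 * h136 + 1/8 * h145 - 1/8 * h235 - 1/8 * h246
    · change k 3 5 = 0
      linear_combination 1/8 * h036 - 1/8 * h045 + 1/8 * h234 - 1/8 * h256
    · change k 3 6 = 0
      linear_combination -1/8 * h035 - 1/8 * h046 + 1/8 * h134 - 1/8 * h156
    · change k 4 4 = 0
      linear_combination 1/4 * h034 - 1/4 * h146 - 1/4 * h245 - 1/2 * ht
    · change k 4 5 = 0
      linear_combination 1/8 * h035 + 1/8 * h046 + 1/8 * h134 - 1/8 * h156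
    · change k 4 6 = 0
      linear_combination 1/8 * h036 - 1/8 * h045 - 1/8 * h234 + 1/8 * h256
    · change k 5 5 = 0
      linear_combination 1/4 * h056 + 1/4 * h135 - 1/4 * h245 - 1/2 * ht
    · change k 5 6 = 0
      linear_combination 1/8 * h136 - 1/8 * h145 - 1/8 * h235 - 1/8 * h246
    · change k 6 6 = 0
      linear_combination 1/4 * h056 - 1/4 * h146 - 1/4 * h236 - 1/2 * ht
  refine bilin_ext fun i j => ?_
  rw [hk, LinearMap.zero_apply, LinearMap.zero_apply]
  rcases le_total i j with hij | hij
  · exact K i j hij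
  · rw [ks, K j i hij]

/-! ### Calibration by `*φ₀` and coassociative planes. -/

theorem inner_eq_sum (x y : V) : inner ℝ x y = ∑ i, x i * y i := by
  rw [PiLp.inner_apply]
  refine Finset.sum_congr rfl fun i _ => ?_
  simp [mul_comm]

set_option maxHeartbeats 4000000 in
/-- `|*φ₀(x, y, z, ·)|² + φ₀(x, y, z)² = |x ∧ y ∧ z|²`. -/
theorem sum_starPhi0_sq (x y z : V) :
    ∑ m, starPhi0 ![x, y, z, e m] ^ 2 + phi0 ![x, y, z] ^ 2 =
      inner ℝ x x * (inner ℝ y y * inner ℝ z z - inner ℝ y z ^ 2) -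
      inner ℝ x y * (inner ℝ x y * inner ℝ z z - inner ℝ y z * inner ℝ x z) +
      inner ℝ x z * (inner ℝ x y * inner ℝ y z - inner ℝ y y * inner ℝ x z) := by
  simp only [inner_eq_sum, Fin.sum_univ_seven, phi0_apply]
  have c0 : starPhi0 ![x, y, z, e 0] =
      (x 1 * (y 3 * z 6 - y 6 * z 3) - x 3 * (y 1 * z 6 - y 6 * z 1) + x 6 * (y 1 * z 3 -
          y 3 * z 1)) +
      (x 1 * (y 4 * z 5 - y 5 * z 4) - x 4 * (y 1 * z 5 - y 5 * z 1) + x 5 * (y 1 * z 4 -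
          y 4 * z 1)) +
      (x 2 * (y 3 * z 5 - y 5 * z 3) - x 3 * (y 2 * z 5 - y 5 * z 2) + x 5 * (y 2 * z 3 -
          y 3 * z 2)) -
      (x 2 * (y 4 * z 6 - y 6 * z 4) - x 4 * (y 2 * z 6 - y 6 * z 2) + x 6 * (y 2 * z 4 -
          y 4 * z 2)) := by
    simp only [starPhi0_apply, e_apply]
    simp
    try ring
  have c1 : starPhi0 ![x, y, z, e 1] = -
      (x 0 * (y 3 * z 6 - y 6 * z 3) - x 3 * (y 0 * z 6 - y 6 * z 0) + x 6 * (y 0 * z 3 -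
          y 3 * z 0)) -
      (x 0 * (y 4 * z 5 - y 5 * z 4) - x 4 * (y 0 * z 5 - y 5 * z 0) + x 5 * (y 0 * z 4 -
          y 4 * z 0)) -
      (x 2 * (y 3 * z 4 - y 4 * z 3) - x 3 * (y 2 * z 4 - y 4 * z 2) + x 4 * (y 2 * z 3 -
          y 3 * z 2)) -
      (x 2 * (y 5 * z 6 - y 6 * z 5) - x 5 * (y 2 * z 6 - y 6 * z 2) + x 6 * (y 2 * z 5 -
          y 5 * z 2)) := by
    simp only [starPhi0_apply, e_apply]
    simp
    try ring
  have c2 : starPhi0 ![x, y, z, e 2] = -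
      (x 0 * (y 3 * z 5 - y 5 * z 3) - x 3 * (y 0 * z 5 - y 5 * z 0) + x 5 * (y 0 * z 3 -
          y 3 * z 0)) +
      (x 0 * (y 4 * z 6 - y 6 * z 4) - x 4 * (y 0 * z 6 - y 6 * z 0) + x 6 * (y 0 * z 4 -
          y 4 * z 0)) +
      (x 1 * (y 3 * z 4 - y 4 * z 3) - x 3 * (y 1 * z 4 - y 4 * z 1) + x 4 * (y 1 * z 3 -
          y 3 * z 1)) +
      (x 1 * (y 5 * z 6 - y 6 * z 5) - x 5 * (y 1 * z 6 - y 6 * z 1) + x 6 * (y 1 * z 5 -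
          y 5 * z 1)) := by
    simp only [starPhi0_apply, e_apply]
    simp
    try ring
  have c3 : starPhi0 ![x, y, z, e 3] =
      (x 0 * (y 1 * z 6 - y 6 * z 1) - x 1 * (y 0 * z 6 - y 6 * z 0) + x 6 * (y 0 * z 1 -
          y 1 * z 0)) +
      (x 0 * (y 2 * z 5 - y 5 * z 2) - x 2 * (y 0 * z 5 - y 5 * z 0) + x 5 * (y 0 * z 2 -
          y 2 * z 0)) -
      (x 1 * (y 2 * z 4 - y 4 * z 2) - x 2 * (y 1 * z 4 - y 4 * z 1) + x 4 * (y 1 * z 2 -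
          y 2 * z 1)) -
      (x 4 * (y 5 * z 6 - y 6 * z 5) - x 5 * (y 4 * z 6 - y 6 * z 4) + x 6 * (y 4 * z 5 -
          y 5 * z 4)) := by
    simp only [starPhi0_apply, e_apply]
    simp
    try ring
  have c4 : starPhi0 ![x, y, z, e 4] =
      (x 0 * (y 1 * z 5 - y 5 * z 1) - x 1 * (y 0 * z 5 - y 5 * z 0) + x 5 * (y 0 * z 1 -
          y 1 * z 0)) -
      (x 0 * (y 2 * z 6 - y 6 * z 2) - x 2 * (y 0 * z 6 - y 6 * z 0) + x 6 * (y 0 * z 2 -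
          y 2 * z 0)) +
      (x 1 * (y 2 * z 3 - y 3 * z 2) - x 2 * (y 1 * z 3 - y 3 * z 1) + x 3 * (y 1 * z 2 -
          y 2 * z 1)) +
      (x 3 * (y 5 * z 6 - y 6 * z 5) - x 5 * (y 3 * z 6 - y 6 * z 3) + x 6 * (y 3 * z 5 -
          y 5 * z 3)) := by
    simp only [starPhi0_apply, e_apply]
    simp
    try ring
  have c5 : starPhi0 ![x, y, z, e 5] = -
      (x 0 * (y 1 * z 4 - y 4 * z 1) - x 1 * (y 0 * z 4 - y 4 * z 0) + x 4 * (y 0 * z 1 -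
          y 1 * z 0)) -
      (x 0 * (y 2 * z 3 - y 3 * z 2) - x 2 * (y 0 * z 3 - y 3 * z 0) + x 3 * (y 0 * z 2 -
          y 2 * z 0)) -
      (x 1 * (y 2 * z 6 - y 6 * z 2) - x 2 * (y 1 * z 6 - y 6 * z 1) + x 6 * (y 1 * z 2 -
          y 2 * z 1)) -
      (x 3 * (y 4 * z 6 - y 6 * z 4) - x 4 * (y 3 * z 6 - y 6 * z 3) + x 6 * (y 3 * z 4 -
          y 4 * z 3)) := by
    simp only [starPhi0_apply, e_apply]
    simp
    try ring
  have c6 : starPhi0 ![x, y, z, e 6] = -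
      (x 0 * (y 1 * z 3 - y 3 * z 1) - x 1 * (y 0 * z 3 - y 3 * z 0) + x 3 * (y 0 * z 1 -
          y 1 * z 0)) +
      (x 0 * (y 2 * z 4 - y 4 * z 2) - x 2 * (y 0 * z 4 - y 4 * z 0) + x 4 * (y 0 * z 2 -
          y 2 * z 0)) +
      (x 1 * (y 2 * z 5 - y 5 * z 2) - x 2 * (y 1 * z 5 - y 5 * z 1) + x 5 * (y 1 * z 2 -
          y 2 * z 1)) +
      (x 3 * (y 4 * z 5 - y 5 * z 4) - x 4 * (y 3 * z 5 - y 5 * z 3) + x 5 * (y 3 * z 4 -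
          y 4 * z 3)) := by
    simp only [starPhi0_apply, e_apply]
    simp
    try ring
  rw [c0, c1, c2, c3, c4, c5, c6]
  ring

theorem inner_e (x : V) (i : Fin 7) : inner ℝ x (e i) = x i := by
  rw [inner_eq_sum]
  simp [e_apply]

theorem starPhi0_eq_sum (x y z u : V) :
    starPhi0 ![x, y, z, u] = ∑ m, u m * starPhi0 ![x, y, z, e m] := by
  simp only [starPhi0_apply, Fin.sum_univ_seven, e_apply]
  simp
  ring

/-- At an orthonormal quadruple on which `*φ₀` attains its maximal modulus, `φ₀` vanishes and
the first variation of `*φ₀` in normal directions is zero. -/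
theorem calibrated {x y z w : V} (hx : inner ℝ x x = 1) (hy : inner ℝ y y = 1)
    (hz : inner ℝ z z = 1) (hw : inner ℝ w w = 1) (hxy : inner ℝ x y = 0) (hxz : inner ℝ x z = 0)
    (hyz : inner ℝ y z = 0) (h : |starPhi0 ![x, y, z, w]| = 1) :
    phi0 ![x, y, z] = 0 ∧
      ∀ u, starPhi0 ![x, y, z, u] = inner ℝ w u * starPhi0 ![x, y, z, w] := by
  have h1 := sum_starPhi0_sq x y z
  rw [hx, hy, hz, hxy, hxz, hyz] at h1
  obtain ⟨s, hs⟩ : ∃ s, starPhi0 ![x, y, z, w] = s := ⟨_, rfl⟩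
  rw [hs] at h ⊢
  have hs2 : s ^ 2 = 1 := by rw [← sq_abs, h, one_pow]
  have h2 := starPhi0_eq_sum x y z w
  rw [hs] at h2
  -- Here `s = ±1` and the norm identity reads `|*φ₀(x,y,z,·)|² = 1 - φ₀(x,y,z)²`. A sum of squares
  -- thus equals minus a square, so both vanish.
  have h3 : ∑ m, (starPhi0 ![x, y, z, e m] - s * w m) ^ 2 = -phi0 ![x, y, z] ^ 2 := by
    have : ∀ m, (starPhi0 ![x, y, z, e m] - s * w m) ^ 2 = starPhi0 ![x, y, z, e m] ^ 2 -
        2 * s * (w m * starPhi0 ![x, y, z, e m]) + s ^ 2 * (w m * w m) := fun m => by ring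
    simp only [this, Finset.sum_add_distrib, Finset.sum_sub_distrib, ← Finset.mul_sum]
    rw [← h2, ← inner_eq_sum, hw]
    linear_combination h1 - hs2
  have h4 : 0 ≤ ∑ m, (starPhi0 ![x, y, z, e m] - s * w m) ^ 2 :=
    Finset.sum_nonneg fun m _ => sq_nonneg _
  have h5 : phi0 ![x, y, z] = 0 := by
    refine pow_eq_zero_iff (n := 2) (by norm_num) |>.mp ?_
    nlinarith [sq_nonneg (phi0 ![x, y, z])]
  refine ⟨h5, fun u => ?_⟩
  rw [h5] at h3
  have h6 : ∀ m, starPhi0 ![x, y, z, e m] = s * w m := fun m => by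
    have := (Finset.sum_eq_zero_iff_of_nonneg fun m _ => sq_nonneg
      (starPhi0 ![x, y, z, e m] - s * w m)).mp (by simpa using h3) m (Finset.mem_univ m)
    exact sub_eq_zero.mp (pow_eq_zero_iff (two_ne_zero) |>.mp this)
  rw [starPhi0_eq_sum, inner_eq_sum, Finset.sum_mul]
  refine Finset.sum_congr rfl fun m _ => ?_
  rw [h6]
  ring

section Coassociative

variable {C : Submodule ℝ V}

theorem IsCoassociativePlane.calibrated_basis (hC : IsCoassociativePlane C)
    (b : OrthonormalBasis (Fin 4) ℝ C) :
    phi0 ![(b 0 : V), b 1, b 2] = 0 ∧ ∀ u, starPhi0 ![(b 0 : V), b 1, b 2, u] =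
      inner ℝ (b 3 : V) u * starPhi0 (fun i => (b i : V)) := by
  have h1 : ∀ i, inner ℝ (b i : V) (b i) = 1 := fun i => by
    rw [← Submodule.coe_inner, b.inner_eq_one]
  have h2 : ∀ i j, i ≠ j → inner ℝ (b i : V) (b j) = 0 := fun i j hij => by
    rw [← Submodule.coe_inner, b.inner_eq_zero hij]
  have hb := hC.2 b
  rw [eq_vec_four fun i => (b i : V)] at hb ⊢
  exact calibrated (h1 0) (h1 1) (h1 2) (h1 3) (h2 _ _ (by decide)) (h2 _ _ (by decide))
    (h2 _ _ (by decide)) hb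

theorem IsCoassociativePlane.calibrated_perm (hC : IsCoassociativePlane C)
    (b : OrthonormalBasis (Fin 4) ℝ C) (σ : Equiv.Perm (Fin 4)) :
    phi0 ![(b (σ 0) : V), b (σ 1), b (σ 2)] = 0 ∧
      ∀ u, starPhi0 ![(b (σ 0) : V), b (σ 1), b (σ 2), u] =
        ((Equiv.Perm.sign σ : ℤ) : ℝ) *
          (inner ℝ (b (σ 3) : V) u * starPhi0 (fun i => (b i : V))) := by
  have h := hC.calibrated_basis (b.reindex σ.symm)
  simp only [OrthonormalBasis.reindex_apply, Equiv.symm_symm] at h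
  refine ⟨h.1, fun u => ?_⟩
  rw [h.2 u, mul_left_comm]
  congr 1
  exact isSkew_form starPhi0 σ fun i => (b i : V)

/-- By alternation it suffices to test distinct vectors of an orthonormal basis of `C`; three such
vectors extend to a reordering of the whole basis, to which `calibrated` applies. -/
theorem IsCoassociativePlane.phi0_eq_zero (hC : IsCoassociativePlane C) {v : Fin 3 → V}
    (hv : ∀ i, v i ∈ C) : phi0 v = 0 := by
  let b : OrthonormalBasis (Fin 4) ℝ C := (stdOrthonormalBasis ℝ C).reindex (finCongr hC.1)
  have h0 : (phi0.compContinuousLinearMap C.subtypeL).toAlternatingMap = 0 := by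
    refine b.toBasis.ext_alternating fun f hf => ?_
    have hdec : ∀ i j k : Fin 4, i ≠ j → i ≠ k → j ≠ k →
      ∃ l, Function.Injective ![i, j, k, l] := by decide
    obtain ⟨l, hl⟩ := hdec (f 0) (f 1) (f 2) (hf.ne (by decide)) (hf.ne (by decide))
      (hf.ne (by decide))
    have := (hC.calibrated_perm b (Equiv.ofBijective _ (Finite.injective_iff_bijective.mp hl))).1
    change phi0 (fun i => (b.toBasis (f i) : V)) = 0
    rw [eq_vec_three fun i => (b.toBasis (f i) : V)]
    simpa using this
  have := congrArg (fun α : C [⋀^Fin 3]→ₗ[ℝ] ℝ => α fun i => ⟨v i, hv i⟩) h0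
  exact this

/-- The first-variation part of `calibrated`, transported to each slot: a permutation moves slot `k`
to the last place, and its sign cancels the one from moving `u` there. -/
theorem IsCoassociativePlane.starPhi0_update (hC : IsCoassociativePlane C)
    (b : OrthonormalBasis (Fin 4) ℝ C) (k : Fin 4) (u : V) :
    starPhi0 (Function.update (fun i => (b i : V)) k u) =
      inner ℝ (b k : V) u * starPhi0 (fun i => (b i : V)) := by
  have hsw : ∀ i j k' : Fin 4, ∀ σ : Equiv.Perm (Fin 4), σ 0 = i → σ 1 = j → σ 2 = k' →
      ∀ u, starPhi0 ![(b i : V), b j, b k', u] = ((Equiv.Perm.sign σ : ℤ) : ℝ) *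
          (inner ℝ (b (σ 3) : V) u * starPhi0 (fun i => (b i : V))) := by
    rintro _ _ _ σ rfl rfl rfl
    exact (hC.calibrated_perm b σ).2
  rw [eq_vec_four (Function.update (fun i => (b i : V)) k u)]
  fin_cases k
  · have h := hsw 1 2 3 (c[0, 1, 2, 3]) (by decide) (by decide) (by decide) u
    have hs : Equiv.Perm.sign (c[0, 1, 2, 3] : Equiv.Perm (Fin 4)) = -1 := by decide
    have h3 : (c[0, 1, 2, 3] : Equiv.Perm (Fin 4)) 3 = 0 := by decide
    rw [hs, h3] at h
    have : starPhi0 ![u, b 1, b 2, b 3] = -starPhi0 ![(b 1 : V), b 2, b 3, u] := by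
      simp only [starPhi0_apply]; ring
    refine this.trans ?_
    rw [h]
    simp
  · have h := hsw 0 2 3 (c[1, 2, 3]) (by decide) (by decide) (by decide) u
    have hs : Equiv.Perm.sign (c[1, 2, 3] : Equiv.Perm (Fin 4)) = 1 := by decide
    have h3 : (c[1, 2, 3] : Equiv.Perm (Fin 4)) 3 = 1 := by decide
    rw [hs, h3] at h
    have : starPhi0 ![(b 0 : V), u, b 2, b 3] = starPhi0 ![(b 0 : V), b 2, b 3, u] := by
      simp only [starPhi0_apply]; ring
    refine this.trans ?_
    rw [h]
    simp
  · have h := hsw 0 1 3 (c[2, 3]) (by decide) (by decide) (by decide) u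
    have hs : Equiv.Perm.sign (c[2, 3] : Equiv.Perm (Fin 4)) = -1 := by decide
    have h3 : (c[2, 3] : Equiv.Perm (Fin 4)) 3 = 2 := by decide
    rw [hs, h3] at h
    have : starPhi0 ![(b 0 : V), b 1, u, b 3] = -starPhi0 ![(b 0 : V), b 1, b 3, u] := by
      simp only [starPhi0_apply]; ring
    refine this.trans ?_
    rw [h]
    simp
  · exact (hC.calibrated_basis b).2 u

end Coassociative

/-! ### Partial traces over `C` and its complement. -/

/-- The trace of a bilinear form over a subspace. -/
def traceOn (S : Submodule ℝ V) (h : LinearMap.BilinForm ℝ V) : ℝ :=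
  ∑ i, h (S.starProjection (e i)) (S.starProjection (e i))

/-- Independence of the trace from the basis, with a free map `T`: the projection to `S` gives
`traceOn`, while the projection to the complement shows that cross terms have zero trace. -/
theorem sum_starProjection {S : Submodule ℝ V} {ι : Type*} [Fintype ι]
    (b : OrthonormalBasis ι ℝ S) (h : LinearMap.BilinForm ℝ V) (T : V →ₗ[ℝ] V) :
    ∑ i, h (S.starProjection (e i)) (T (e i)) = ∑ k, h (b k) (T (b k)) := by
  have hP : ∀ i, S.starProjection (e i) = ∑ k, (b k : V) i • (b k : V) := fun i => by
    rw [b.starProjection_eq_sum_rankOne]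
    simp [inner_e]
  simp only [hP, map_sum, map_smul, LinearMap.sum_apply, LinearMap.smul_apply]
  rw [Finset.sum_comm]
  refine Finset.sum_congr rfl fun k _ => ?_
  have hT : T (b k) = ∑ i, (b k : V) i • T (e i) := by
    conv_lhs => rw [← sum_coord (b k)]
    simp only [map_sum, map_smul]
  rw [hT]
  simp only [map_sum, map_smul]

theorem traceOn_eq_sum {S : Submodule ℝ V} {ι : Type*} [Fintype ι]
    (b : OrthonormalBasis ι ℝ S) (h : LinearMap.BilinForm ℝ V) :
    traceOn S h = ∑ k, h (b k) (b k) := by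
  have := sum_starProjection b h (S.starProjection : V →ₗ[ℝ] V)
  simpa [traceOn, Submodule.starProjection_eq_self_iff.mpr] using this

theorem trace_eq_traceOn_add (S : Submodule ℝ V) (h : LinearMap.BilinForm ℝ V) :
    trace h = traceOn S h + traceOn Sᗮ h := by
  have h1 := sum_starProjection (stdOrthonormalBasis ℝ S) h (Sᗮ.starProjection : V →ₗ[ℝ] V)
  have h2 := sum_starProjection (stdOrthonormalBasis ℝ Sᗮ) h (S.starProjection : V →ₗ[ℝ] V)
  have z1 : ∀ v : S, Sᗮ.starProjection (v : V) = 0 := fun v =>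
    (Submodule.starProjection_apply_eq_zero_iff _).mpr (by simp)
  have z2 : ∀ v : Sᗮ, S.starProjection (v : V) = 0 := fun v =>
    (Submodule.starProjection_apply_eq_zero_iff _).mpr v.2
  simp only [ContinuousLinearMap.coe_coe, z1, z2, map_zero, Finset.sum_const_zero] at h1 h2
  have h3 : ∀ i, h (e i) (e i) = h (S.starProjection (e i)) (S.starProjection (e i)) +
      h (Sᗮ.starProjection (e i)) (Sᗮ.starProjection (e i)) +
      (h (S.starProjection (e i)) (Sᗮ.starProjection (e i)) +
      h (Sᗮ.starProjection (e i)) (S.starProjection (e i))) := fun i => by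
    conv_lhs => rw [← S.starProjection_add_starProjection_orthogonal (e i)]
    simp only [map_add, LinearMap.add_apply]
    ring
  simp only [trace, traceOn, h3, Finset.sum_add_distrib, h1, h2, add_zero]

theorem sum_mul_bilin (h : LinearMap.BilinForm ℝ V) (x y : V) :
    ∑ i, ∑ j, h (e i) (e j) * (x i * y j) = h x y := by
  conv_rhs => rw [← sum_coord x, ← sum_coord y]
  simp only [map_sum, map_smul, LinearMap.sum_apply, LinearMap.smul_apply, smul_eq_mul,
    Finset.mul_sum]
  rw [Finset.sum_comm]
  refine Finset.sum_congr rfl fun i _ => Finset.sum_congr rfl fun j _ => ?_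
  ring

/-- For traceless `h` only the derivation term of `star_iMap` survives. By `starPhi0_update`, on an
orthonormal basis of `C` it sees only the diagonal entries of `h`, which add up to the trace over
`C`. -/
theorem star_iMap_basis {C : Submodule ℝ V} (hC : IsCoassociativePlane C)
    (b : OrthonormalBasis (Fin 4) ℝ C) {h : LinearMap.BilinForm ℝ V} (hs : ∀ v w, h v w = h w v)
    (ht : trace h = 0) :
    star (k := 3) (l := 4) (by norm_num) (iMap h) (fun i => (b i : V)) =
      -2 * traceOn C h * starPhi0 (fun i => (b i : V)) := by
  rw [star_iMap hs, ht, traceOn_eq_sum b]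
  simp only [hC.starPhi0_update, inner_e]
  have : ∑ i, ∑ j, h (e i) (e j) * ∑ k, (b k : V) j *
      ((b k : V) i * starPhi0 (fun i => (b i : V))) =
      ∑ k, h (b k) (b k) * starPhi0 (fun i => (b i : V)) := by
    simp only [← sum_mul_bilin h (b _) (b _), Fin.sum_univ_four, Finset.sum_mul, mul_add,
      Finset.sum_add_distrib]
    congr 1
    · congr 1
      · congr 1
        all_goals
          refine Finset.sum_congr rfl fun i _ => Finset.sum_congr rfl fun j _ => ?_
          ring
      · refine Finset.sum_congr rfl fun i _ => Finset.sum_congr rfl fun j _ => ?_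
        ring
    · refine Finset.sum_congr rfl fun i _ => Finset.sum_congr rfl fun j _ => ?_
      ring
  rw [this, ← Finset.sum_mul]
  ring

theorem traceOn_add (S : Submodule ℝ V) (h k : LinearMap.BilinForm ℝ V) :
    traceOn S (h + k) = traceOn S h + traceOn S k := by
  simp [traceOn, Finset.sum_add_distrib]

theorem traceOn_smul (S : Submodule ℝ V) (c : ℝ) (h : LinearMap.BilinForm ℝ V) :
    traceOn S (c • h) = c * traceOn S h := by
  simp [traceOn, Finset.mul_sum]

theorem traceOn_eq_zero {S : Submodule ℝ V} {h : LinearMap.BilinForm ℝ V}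
    (H : ∀ v ∈ S, h v v = 0) : traceOn S h = 0 :=
  Finset.sum_eq_zero fun _ _ => H _ (S.starProjection_apply_mem _)

theorem traceOn_eq_finrank {S : Submodule ℝ V} {h : LinearMap.BilinForm ℝ V} {c : ℝ}
    (H : ∀ v ∈ S, h v v = c * inner ℝ v v) : traceOn S h = c * Module.finrank ℝ S := by
  rw [traceOn_eq_sum (stdOrthonormalBasis ℝ S)]
  have : ∀ i, h (stdOrthonormalBasis ℝ S i) (stdOrthonormalBasis ℝ S i) = c := fun i => by
    rw [H _ (Subtype.coe_prop _), ← Submodule.coe_inner, OrthonormalBasis.inner_eq_one, mul_one]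
  simp [this, mul_comm]

theorem trace_eq_zero_iff_traceOn (S : Submodule ℝ V) (h : LinearMap.BilinForm ℝ V) :
    trace h = 0 ↔ traceOn Sᗮ h = -traceOn S h := by
  rw [trace_eq_traceOn_add S, add_comm, add_eq_zero_iff_eq_neg]

/-! ### The splitting of `Λ³₂₇` relative to `C`. -/

section Splitting

variable (C : Submodule ℝ V)

theorem E0_apply (v w : V) : E0 C v w =
    4 * inner ℝ (Cᗮ.starProjection v) (Cᗮ.starProjection w) -
      3 * inner ℝ (C.starProjection v) (C.starProjection w) := rfl

theorem E0_symm (v w : V) : E0 C v w = E0 C w v := by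
  rw [E0_apply, E0_apply, real_inner_comm, real_inner_comm (C.starProjection v)]

variable {C}

theorem starProjection_of_mem {v : V} (hv : v ∈ C) : C.starProjection v = v :=
  Submodule.starProjection_eq_self_iff.mpr hv

theorem starProjection_orthogonal_of_mem {v : V} (hv : v ∈ C) : Cᗮ.starProjection v = 0 :=
  (Submodule.starProjection_apply_eq_zero_iff _).mpr (by simpa using hv)

theorem starProjection_of_mem_orthogonal {v : V} (hv : v ∈ Cᗮ) : C.starProjection v = 0 :=
  (Submodule.starProjection_apply_eq_zero_iff _).mpr hv

theorem traceOn_E0 (hC : Module.finrank ℝ C = 4) : traceOn C (E0 C) = -12 := by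
  rw [traceOn_eq_finrank (c := -3) fun v hv => ?_, hC]
  · norm_num
  · rw [E0_apply, starProjection_of_mem hv, starProjection_orthogonal_of_mem hv, inner_zero_left]
    ring

theorem finrank_orthogonal_eq_three (hC : Module.finrank ℝ C = 4) :
    Module.finrank ℝ Cᗮ = 3 := by
  have := C.finrank_add_finrank_orthogonal
  rw [hC, finrank_euclideanSpace_fin] at this
  omega

theorem traceOn_orthogonal_E0 (hC : Module.finrank ℝ C = 4) : traceOn Cᗮ (E0 C) = 12 := by
  rw [traceOn_eq_finrank (c := 4) fun v hv => ?_, finrank_orthogonal_eq_three hC]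
  · norm_num
  · rw [E0_apply, starProjection_of_mem hv, starProjection_of_mem_orthogonal hv, inner_zero_left]
    ring

theorem trace_E0 (hC : Module.finrank ℝ C = 4) : trace (E0 C) = 0 := by
  rw [trace_eq_traceOn_add C, traceOn_E0 hC, traceOn_orthogonal_E0 hC]
  norm_num

/-- `E₀` is traceless and has trace `-12` on `C`, so injectivity of `i` applies. Consequently
`dagger` is never its dummy value on a plane of dimension four. -/
theorem iMap_E0_ne_zero (hC : Module.finrank ℝ C = 4) : iMap (E0 C) ≠ 0 := fun h => by
  have h1 := traceOn_E0 hC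
  rw [eq_zero_of_iMap_eq_zero (E0_symm C) (trace_E0 hC) h] at h1
  simp [traceOn] at h1

theorem dagger_smul (hC : Module.finrank ℝ C = 4) (t : ℝ)
    (ht : t • iMap (E0 C) ∈ Lam27Inv C) : dagger C ⟨t • iMap (E0 C), ht⟩ = 4 * √42 * t := by
  have hd : dagger C = (4 * √42) • (LinearEquiv.toSpanNonzeroSingleton ℝ (Lam 3) (iMap (E0 C))
    (iMap_E0_ne_zero hC)).symm.toLinearMap := dif_pos (iMap_E0_ne_zero hC)
  have : (LinearEquiv.toSpanNonzeroSingleton ℝ (Lam 3) (iMap (E0 C)) (iMap_E0_ne_zero hC)).symm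
      ⟨t • iMap (E0 C), ht⟩ = t := by
    rw [LinearEquiv.symm_apply_eq]
    rfl
  rw [hd]
  exact congrArg (fun x => 4 * √42 * x) this

theorem trace_of_mem_Sym20 {h : LinearMap.BilinForm ℝ V} {S : Submodule ℝ V} (hh : h ∈ Sym20 S) :
    traceOn S h = 0 ∧ traceOn Sᗮ h = 0 := by
  obtain ⟨-, h2, h3⟩ := hh
  have h4 : traceOn Sᗮ h = 0 := traceOn_eq_zero fun v hv => h2 v hv v
  rw [trace_eq_traceOn_add S, h4, add_zero] at h3
  exact ⟨h3, h4⟩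

/-- A traceless symmetric form is a multiple of `E₀` plus traceless symmetric forms on `Cᗮ` and
on `C` plus a mixed form. -/
theorem exists_splitting (hC : Module.finrank ℝ C = 4) {h : LinearMap.BilinForm ℝ V}
    (hs : ∀ v w, h v w = h w v) (ht : trace h = 0) :
    ∃ a ∈ Sym20 Cᗮ, ∃ c ∈ Sym20 C, ∃ m ∈ SymMixed C,
      h = (-traceOn C h / 12) • E0 C + a + c + m := by
  -- Since `E₀` has trace `-12` on `C`, this `t` makes `h - t E₀` traceless on `C`, and on the
  -- complement too because `h` and `E₀` are traceless on `V`. The four blocks of the difference are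
  -- then the required pieces.
  set t := -traceOn C h / 12 with htdef
  set k := h + (-t) • E0 C with hk
  have hks : ∀ v w, k v w = k w v := fun v w => by
    simp only [hk, LinearMap.add_apply, LinearMap.smul_apply, hs v w, E0_symm C v w]
  have hkC : traceOn C k = 0 := by
    rw [hk, traceOn_add, traceOn_smul, traceOn_E0 hC, htdef]
    ring
  have hkA : traceOn Cᗮ k = 0 := by
    rw [hk, traceOn_add, traceOn_smul, traceOn_orthogonal_E0 hC,
      (trace_eq_zero_iff_traceOn C h).mp ht, htdef]
    ring
  have hPP : ∀ {S : Submodule ℝ V} (v : V), S.starProjection (S.starProjection v) =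
    S.starProjection v := fun v => starProjection_of_mem (Submodule.starProjection_apply_mem _ v)
  have hsym : ∀ S : Submodule ℝ V, traceOn S k = 0 →
      k.compl₁₂ (S.starProjection : V →ₗ[ℝ] V) (S.starProjection : V →ₗ[ℝ] V) ∈ Sym20 S := by
    intro S hS
    refine ⟨fun v w => hks _ _, fun v hv w => ?_, hS⟩
    simp [LinearMap.compl₁₂_apply, starProjection_of_mem_orthogonal hv]
  refine ⟨_, hsym Cᗮ hkA, _, hsym C hkC,
    k.compl₁₂ (C.starProjection : V →ₗ[ℝ] V) (Cᗮ.starProjection : V →ₗ[ℝ] V) +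
    k.compl₁₂ (Cᗮ.starProjection : V →ₗ[ℝ] V) (C.starProjection : V →ₗ[ℝ] V), ?_, ?_⟩
  · refine ⟨fun v w => ?_, fun v hv w hw => ?_, fun v hv w hw => ?_⟩
    · simp only [LinearMap.add_apply, LinearMap.compl₁₂_apply]
      rw [add_comm, hks, hks (Cᗮ.starProjection.toLinearMap w)]
    · simp [LinearMap.compl₁₂_apply, starProjection_orthogonal_of_mem hv,
        starProjection_orthogonal_of_mem hw]
    · simp [LinearMap.compl₁₂_apply, starProjection_of_mem_orthogonal hv,
        starProjection_of_mem_orthogonal hw]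
  · have hk' : h = t • E0 C + k := by
      refine LinearMap.ext₂ fun v w => ?_
      simp only [hk, LinearMap.add_apply, LinearMap.smul_apply, smul_eq_mul]
      ring
    have hsplit : k = k.compl₁₂ (Cᗮ.starProjection : V →ₗ[ℝ] V) (Cᗮ.starProjection : V →ₗ[ℝ] V) +
        k.compl₁₂ (C.starProjection : V →ₗ[ℝ] V) (C.starProjection : V →ₗ[ℝ] V) +
        (k.compl₁₂ (C.starProjection : V →ₗ[ℝ] V) (Cᗮ.starProjection : V →ₗ[ℝ] V) +
        k.compl₁₂ (Cᗮ.starProjection : V →ₗ[ℝ] V) (C.starProjection : V →ₗ[ℝ] V)) := by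
      refine LinearMap.ext fun v => LinearMap.ext fun w => ?_
      conv_lhs => rw [← C.starProjection_add_starProjection_orthogonal v,
        ← C.starProjection_add_starProjection_orthogonal w]
      simp only [map_add, LinearMap.add_apply, LinearMap.compl₁₂_apply,
        ContinuousLinearMap.coe_coe]
      ring
    conv_lhs => rw [hk', hsplit]
    abel

/-- The component of `γ ∈ Λ³₂₇` in the line spanned by `i(E₀)` exists, is unique, and is determined
by the value of `*γ` on the coassociative plane `C`. -/
theorem exists_unique_invComponent (hC : IsCoassociativePlane C) {γ : Lam 3}
    (h1 : wedge γ phi0 = 0) (h2 : wedge γ starPhi0 = 0) (b : OrthonormalBasis (Fin 4) ℝ C) :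
    ∃ γ₀ : Lam27Inv C, IsInvComponent C γ γ₀ ∧ (∀ γ', IsInvComponent C γ γ' → γ' = γ₀) ∧
      star (k := 3) (l := 4) (by norm_num) γ (fun i => (b i : V)) =
        √42 / 7 * dagger C γ₀ * starPhi0 (fun i => (b i : V)) := by
  obtain ⟨h, hs, ht, rfl⟩ := exists_iMap_eq h1 h2
  obtain ⟨a, ha, c, hc, m, hm, hdec⟩ := exists_splitting hC.1 hs ht
  have hmem : ∀ t : ℝ, t • iMap (E0 C) ∈ Lam27Inv C := fun t =>
    Submodule.smul_mem _ _ (Submodule.mem_span_singleton_self _)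
  refine ⟨⟨(-traceOn C h / 12) • iMap (E0 C), hmem _⟩, ⟨a, ha, c, hc, m, hm, ?_⟩, ?_, ?_⟩
  · conv_lhs => rw [hdec]
    simp only [iMap_add, iMap_smul]
  · rintro ⟨γ', hγ'⟩ ⟨a', ha', c', hc', m', hm', heq⟩
    obtain ⟨t', rfl⟩ := Submodule.mem_span_singleton.mp hγ'
    have hC4 := hC.1
    -- The difference between `h` and the form of a competing decomposition is traceless and killed
    -- by `i`, hence zero. Its trace over `C` determines `t'`, as `a'`, `c'` and `m'` have no trace
    -- there.
    set k := h + (-1 : ℝ) • (t' • E0 C + a' + c' + m') with hk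
    have hmt : traceOn C m' = 0 ∧ traceOn Cᗮ m' = 0 :=
      ⟨traceOn_eq_zero fun v hv => hm'.2.1 v hv v hv,
        traceOn_eq_zero fun v hv => hm'.2.2 v hv v hv⟩
    have hat := trace_of_mem_Sym20 ha'
    rw [Submodule.orthogonal_orthogonal] at hat
    have hct := trace_of_mem_Sym20 hc'
    have hk0 : k = 0 := by
      apply eq_zero_of_iMap_eq_zero
      · intro v w
        simp only [hk, LinearMap.add_apply, LinearMap.smul_apply, hs v w, E0_symm C v w,
          ha'.1 v w, hc'.1 v w, hm'.1 v w]
      · rw [trace_eq_traceOn_add C]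
        simp only [hk, traceOn_add, traceOn_smul, hat, hct, hmt, traceOn_E0 hC4,
          traceOn_orthogonal_E0 hC4, (trace_eq_zero_iff_traceOn C h).mp ht]
        ring
      · simp only [hk, iMap_add, iMap_smul]
        rw [heq]
        refine ContinuousAlternatingMap.ext fun v => ?_
        simp
        ring
    have hkt : traceOn C k = 0 := by rw [hk0]; simp [traceOn]
    simp only [hk, traceOn_add, traceOn_smul, hat, hct, hmt, traceOn_E0 hC4] at hkt
    have : t' = -traceOn C h / 12 := by linarith
    simp only [this]
  · rw [star_iMap_basis hC b hs ht, dagger_smul hC.1]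
    have h42 : √42 * √42 = 42 := Real.mul_self_sqrt (by norm_num)
    -- The constants agree because `(√42/7)·4√42 = 24 = (-2)·(-12)`.
    linear_combination (traceOn C h * starPhi0 (fun i => (b i : V)) / 21) * h42

end Splitting

/-! ### Exterior derivatives and pullback to the immersed 4-manifold. -/

open scoped Topology

theorem extDeriv_apply_eq_zero_of_pullback {E F : Type*} [NormedAddCommGroup E] [NormedSpace ℝ E]
    [NormedAddCommGroup F] [NormedSpace ℝ F] {n : ℕ} {α : F → F [⋀^Fin n]→L[ℝ] ℝ} {g : E → F}
    {q : E} (hα : DifferentiableAt ℝ α (g q)) (hg : ContDiffAt ℝ ∞ g q)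
    (h : ∀ᶠ y in 𝓝 q, (α (g y)).compContinuousLinearMap (fderiv ℝ g y) = 0) :
    (extDeriv α (g q)).compContinuousLinearMap (fderiv ℝ g q) = 0 := by
  rw [← extDeriv_pullback hα hg (by
    rw [minSmoothness_of_isRCLikeNormedField]
    exact WithTop.coe_le_coe.mpr (le_top : (2 : ℕ∞) ≤ ⊤))]
  have h' : (fun y => (α (g y)).compContinuousLinearMap (fderiv ℝ g y)) =ᶠ[𝓝 q] fun _ => 0 := h
  rw [h'.extDeriv_eq]
  ext v
  simp [extDeriv, ContinuousAlternatingMap.alternatizeUncurryFin_apply]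

variable {M : Type*} [TopologicalSpace M] [ChartedSpace V M] [IsManifold 𝓘(ℝ, V) ∞ M]
  {S : Type*} [TopologicalSpace S] [ChartedSpace R4 S] [IsManifold 𝓘(ℝ, R4) ∞ S]

/-- This is `f^*η = 0 ⟹ f^*(dη) = 0`. As `extD` at `f p` is defined in the chart at `f p`, the claim
is the naturality of the flat exterior derivative under the local expression `g` of `f`. -/
theorem extD_pullback_eq_zero {n : ℕ} {η : FormField M n} (hη : IsSmoothForm η) {f : S → M}
    (hf : ContMDiff 𝓘(ℝ, R4) 𝓘(ℝ, V) ∞ f)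
    (h : ∀ p (w : Fin n → TangentSpace 𝓘(ℝ, R4) p),
      η (f p) (fun i => mfderiv 𝓘(ℝ, R4) 𝓘(ℝ, V) f p (w i)) = 0)
    (p : S) (w : Fin (n + 1) → TangentSpace 𝓘(ℝ, R4) p) :
    extD η (f p) (fun i => mfderiv 𝓘(ℝ, R4) 𝓘(ℝ, V) f p (w i)) = 0 := by
  set ψ := chartAt V (f p) with hψ
  set χ := chartAt R4 p with hχ
  set g : R4 → V := fun y => ψ (f (χ.symm y)) with hg
  have hp : p ∈ χ.source := mem_chart_source R4 p
  have hfp : f p ∈ ψ.source := mem_chart_source V (f p)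
  have hq : χ p ∈ χ.target := χ.map_source hp
  have hcont : Continuous f := hf.continuous
  have hχs : ContMDiffOn 𝓘(ℝ, R4) 𝓘(ℝ, R4) ∞ χ.symm χ.target := contMDiffOn_chart_symm
  have hψs : ContMDiffOn 𝓘(ℝ, V) 𝓘(ℝ, V) ∞ ψ ψ.source := contMDiffOn_chart
  -- near `χ p` the point `χ.symm y` stays in the domain of the chart of `M`
  have hnear : ∀ᶠ y in 𝓝 (χ p), y ∈ χ.target ∧ f (χ.symm y) ∈ ψ.source := by
    refine Filter.Eventually.and (χ.open_target.mem_nhds hq) ?_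
    have hc : ContinuousAt (fun y => f (χ.symm y)) (χ p) :=
      hcont.continuousAt.comp (χ.continuousAt_symm hq)
    refine hc.preimage_mem_nhds (ψ.open_source.mem_nhds ?_)
    rwa [χ.left_inv hp]
  have hgm : ∀ y, y ∈ χ.target → f (χ.symm y) ∈ ψ.source →
      HasMFDerivAt 𝓘(ℝ, R4) 𝓘(ℝ, V) g y
        ((mfderiv 𝓘(ℝ, V) 𝓘(ℝ, V) ψ (f (χ.symm y))).comp
          ((mfderiv 𝓘(ℝ, R4) 𝓘(ℝ, V) f (χ.symm y)).comp
            (mfderiv 𝓘(ℝ, R4) 𝓘(ℝ, R4) χ.symm y))) := by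
    intro y hy hfy
    have d1 : MDifferentiableAt 𝓘(ℝ, R4) 𝓘(ℝ, R4) χ.symm y :=
      (hχs.contMDiffAt (χ.open_target.mem_nhds hy)).mdifferentiableAt (by simp)
    have d2 : MDifferentiableAt 𝓘(ℝ, R4) 𝓘(ℝ, V) f (χ.symm y) :=
      (hf _).mdifferentiableAt (by simp)
    have d3 : MDifferentiableAt 𝓘(ℝ, V) 𝓘(ℝ, V) ψ (f (χ.symm y)) :=
      (hψs.contMDiffAt (ψ.open_source.mem_nhds hfy)).mdifferentiableAt (by simp)
    exact d3.hasMFDerivAt.comp y (d2.hasMFDerivAt.comp y d1.hasMFDerivAt)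
  -- The base point is a variable `z`, since `χ.symm (χ p) = p` is not definitional and derivatives
  -- depend on the point; all tangent spaces are identified with the model space.
  have hgf : ∀ y z, y ∈ χ.target → χ.symm y = z → f z ∈ ψ.source → ∀ v,
      fderiv ℝ g y v = (mfderiv 𝓘(ℝ, V) 𝓘(ℝ, V) ψ (f z) : V →L[ℝ] V)
        ((mfderiv 𝓘(ℝ, R4) 𝓘(ℝ, V) f z : R4 →L[ℝ] V)
          ((mfderiv 𝓘(ℝ, R4) 𝓘(ℝ, R4) χ.symm y : R4 →L[ℝ] R4) v)) := by
    rintro y _ hy rfl hfy v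
    have hd := HasFDerivAt.fderiv (𝕜 := ℝ) (E := R4) (F := V) (f := g) (x := y)
      (hasMFDerivAt_iff_hasFDerivAt.mp (hgm y hy hfy))
    exact congrArg (fun A : R4 →L[ℝ] V => A v) hd
  have hinvψ : ∀ x ∈ ψ.source, ∀ v, (mfderiv 𝓘(ℝ, V) 𝓘(ℝ, V) ψ.symm (ψ x) : V →L[ℝ] V)
      ((mfderiv 𝓘(ℝ, V) 𝓘(ℝ, V) ψ x : V →L[ℝ] V) v) = v := fun x hx v =>
    congrArg (fun A : V →L[ℝ] V => A v)
      ((mdifferentiable_chart (I := 𝓘(ℝ, V)) (f p)).symm_comp_deriv hx)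
  have hinvχ : ∀ v, (mfderiv 𝓘(ℝ, R4) 𝓘(ℝ, R4) χ.symm (χ p) : R4 →L[ℝ] R4)
      ((mfderiv 𝓘(ℝ, R4) 𝓘(ℝ, R4) χ p : R4 →L[ℝ] R4) v) = v := fun v =>
    congrArg (fun A : R4 →L[ℝ] R4 => A v)
      ((mdifferentiable_chart (I := 𝓘(ℝ, R4)) p).symm_comp_deriv hp)
  have hgq : g (χ p) = ψ (f p) := by simp only [hg, χ.left_inv hp]
  have hgc : ContDiffAt ℝ ∞ g (χ p) := by
    rw [← contMDiffAt_iff_contDiffAt]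
    have c1 : ContMDiffAt 𝓘(ℝ, R4) 𝓘(ℝ, R4) ∞ χ.symm (χ p) :=
      hχs.contMDiffAt (χ.open_target.mem_nhds hq)
    have c3 : ContMDiffAt 𝓘(ℝ, V) 𝓘(ℝ, V) ∞ ψ (f (χ.symm (χ p))) := by
      rw [χ.left_inv hp]
      exact hψs.contMDiffAt (ψ.open_source.mem_nhds hfp)
    exact c3.comp (χ p) ((hf _).comp (χ p) c1)
  have hω : DifferentiableAt ℝ (inChart η (f p)) (g (χ p)) := by
    rw [hgq]
    exact ((hη (f p)).contDiffAt (ψ.open_target.mem_nhds (ψ.map_source hfp))).differentiableAt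
      (by simp)
  -- The derivative of `ψ.symm` in `inChart` cancels that of `ψ` in `g`, leaving `η` on images of
  -- vectors under the derivative of `f`. Vanishing is needed on a whole neighbourhood, as it is
  -- going to be differentiated.
  have hzero : ∀ᶠ y in 𝓝 (χ p),
      (inChart η (f p) (g y)).compContinuousLinearMap (fderiv ℝ g y) = 0 := by
    filter_upwards [hnear] with y ⟨hy, hfy⟩
    ext v
    have hback : ψ.symm (g y) = f (χ.symm y) := ψ.left_inv hfy
    have hvec : ∀ i, (mfderiv 𝓘(ℝ, V) 𝓘(ℝ, V) ψ.symm (g y) : V →L[ℝ] V) (fderiv ℝ g y (v i)) =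
        (mfderiv 𝓘(ℝ, R4) 𝓘(ℝ, V) f (χ.symm y) : R4 →L[ℝ] V)
          ((mfderiv 𝓘(ℝ, R4) 𝓘(ℝ, R4) χ.symm y : R4 →L[ℝ] R4) (v i)) := fun i => by
      rw [hgf y _ hy rfl hfy]
      exact hinvψ _ hfy _
    change (η (ψ.symm (g y)) : Lam n) (fun i =>
      (mfderiv 𝓘(ℝ, V) 𝓘(ℝ, V) ψ.symm (g y) : V →L[ℝ] V) (fderiv ℝ g y (v i))) = 0
    simp only [hvec]
    refine (congrArg (fun x => (η x : Lam n) fun i =>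
      (mfderiv 𝓘(ℝ, R4) 𝓘(ℝ, V) f (χ.symm y) : R4 →L[ℝ] V)
          ((mfderiv 𝓘(ℝ, R4) 𝓘(ℝ, R4) χ.symm y : R4 →L[ℝ] R4) (v i))) hback).trans ?_
    exact h (χ.symm y) _
  have key := extDeriv_apply_eq_zero_of_pullback hω hgc hzero
  -- Evaluation at the images of `w` under the derivative of `χ` undoes the derivative of `χ.symm`
  -- contained in `g`.
  have key' := congrArg (fun α : R4 [⋀^Fin (n + 1)]→L[ℝ] ℝ =>
    α fun i => (mfderiv 𝓘(ℝ, R4) 𝓘(ℝ, R4) χ p : R4 →L[ℝ] R4) (w i)) key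
  replace key' : extDeriv (inChart η (f p)) (g (χ p)) (fun i => fderiv ℝ g (χ p)
      ((mfderiv 𝓘(ℝ, R4) 𝓘(ℝ, R4) χ p : R4 →L[ℝ] R4) (w i))) = 0 := key'
  have hvec : ∀ i, fderiv ℝ g (χ p) ((mfderiv 𝓘(ℝ, R4) 𝓘(ℝ, R4) χ p : R4 →L[ℝ] R4) (w i)) =
      (mfderiv 𝓘(ℝ, V) 𝓘(ℝ, V) ψ (f p) : V →L[ℝ] V)
        ((mfderiv 𝓘(ℝ, R4) 𝓘(ℝ, V) f p : R4 →L[ℝ] V) (w i)) := fun i => by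
    refine (hgf (χ p) p hq (χ.left_inv hp) hfp _).trans ?_
    exact congrArg (fun v : R4 => (mfderiv 𝓘(ℝ, V) 𝓘(ℝ, V) ψ (f p) : V →L[ℝ] V)
      ((mfderiv 𝓘(ℝ, R4) 𝓘(ℝ, V) f p : R4 →L[ℝ] V) v)) (hinvχ (w i))
  have key'' := (congrArg (fun u => extDeriv (inChart η (f p)) (g (χ p)) u)
    (funext hvec)).symm.trans key'
  rw [hgq] at key''
  exact key''

/-! ### Torsion along a coassociative 4-fold. -/

namespace G2Structure

variable {M : Type*} [TopologicalSpace M] [ChartedSpace V M]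

theorem form_apply (φ : G2Structure M) (x : M) (v : Fin 3 → TangentSpace 𝓘(ℝ, V) x) :
    φ.form x v = phi0 fun i => φ.coframe x (v i) := by
  have h : φ.form x = phi0.compContinuousLinearMap
    (φ.coframe x : TangentSpace 𝓘(ℝ, V) x →L[ℝ] V) := (φ.exists_coframe x).choose_spec
  rw [h]
  rfl

theorem toModel_apply (φ : G2Structure M) {k : ℕ} {x : M}
    (α : (TangentSpace 𝓘(ℝ, V) x) [⋀^Fin k]→L[ℝ] ℝ) (v : Fin k → V) :
    φ.toModel α v = α fun i => (φ.coframe x).symm (v i) := rfl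

theorem hodge_apply (φ : G2Structure M) {k l : ℕ} (h : k + l = 7) {x : M}
    (α : (TangentSpace 𝓘(ℝ, V) x) [⋀^Fin k]→L[ℝ] ℝ) (v : Fin l → TangentSpace 𝓘(ℝ, V) x) :
    φ.hodge h α v = star h (φ.toModel α) fun i => φ.coframe x (v i) := rfl

theorem toModel_form (φ : G2Structure M) (x : M) : φ.toModel (φ.form x) = phi0 := by
  ext v
  rw [toModel_apply, form_apply]
  simp

theorem toModel_starForm (φ : G2Structure M) (x : M) : φ.toModel (φ.starForm x) = starPhi0 := by
  ext v
  rw [toModel_apply, starForm, hodge_apply, toModel_form]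
  simp [starPhi0]

theorem toModel_wedge (φ : G2Structure M) {k l : ℕ} {x : M}
    (α : (TangentSpace 𝓘(ℝ, V) x) [⋀^Fin k]→L[ℝ] ℝ)
    (β : (TangentSpace 𝓘(ℝ, V) x) [⋀^Fin l]→L[ℝ] ℝ) :
    φ.toModel (wedge α β) = wedge (φ.toModel α) (φ.toModel β) :=
  wedge_comp α β _

variable [IsManifold 𝓘(ℝ, V) ∞ M] {φ : G2Structure M} {τ₀ : M → ℝ} {τ₁ : FormField M 1}
  {τ₂ : FormField M 2} {τ₃ : FormField M 3}
  {S : Type*} [TopologicalSpace S] [ChartedSpace R4 S] [IsManifold 𝓘(ℝ, R4) ∞ S] {f : S → M}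

/-- `τ₀ *φ + *τ₃` vanishes on the tangent planes of a coassociative 4-fold. -/
theorem IsTorsion.tau0_mul_starPhi0_add (hτ : φ.IsTorsion τ₀ τ₁ τ₂ τ₃) (hf : φ.IsCoassociative f)
    (p : S) {c : Fin 4 → V} (hc : ∀ i, c i ∈ φ.tangentPlane f p) :
    τ₀ (f p) * starPhi0 c + star (k := 3) (by norm_num) (φ.toModel (τ₃ (f p))) c = 0 := by
  have hphi : ∀ q (w : Fin 3 → TangentSpace 𝓘(ℝ, R4) q),
      φ.form (f q) (fun i => mfderiv 𝓘(ℝ, R4) 𝓘(ℝ, V) f q (w i)) = 0 := fun q w => by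
    rw [form_apply]
    exact (hf.coassociative q).phi0_eq_zero fun i =>
      Submodule.mem_map_of_mem (LinearMap.mem_range_self _ _)
  have hex : ∀ i, ∃ w : TangentSpace 𝓘(ℝ, R4) p,
      φ.coframe (f p) (mfderiv 𝓘(ℝ, R4) 𝓘(ℝ, V) f p w) = c i := fun i => by
    obtain ⟨_, ⟨w, rfl⟩, hw⟩ := hc i
    exact ⟨w, hw⟩
  choose w hw using hex
  have h := extD_pullback_eq_zero φ.smooth hf.smooth hphi p w
  rw [hτ.d_form] at h
  simp only [ContinuousAlternatingMap.add_apply, ContinuousAlternatingMap.smul_apply,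
    smul_eq_mul] at h
  -- Every term of `τ₁ ∧ φ` on tangent vectors contains a value of `φ` on tangent vectors.
  have h1 : wedge (τ₁ (f p)) (φ.form (f p))
      (fun i => mfderiv 𝓘(ℝ, R4) 𝓘(ℝ, V) f p (w i)) = 0 := by
    rw [wedge_apply]
    refine mul_eq_zero_of_right _ (Finset.sum_eq_zero fun σ _ => ?_)
    rw [hphi p fun j => w (σ (Fin.natAdd 1 j)), mul_zero, mul_zero]
  rw [h1, starForm, hodge_apply, hodge_apply, toModel_form] at h
  simp only [hw] at h
  rw [mul_zero, add_zero] at h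
  exact h

theorem IsTorsion.exists_unique_invComponent (hτ : φ.IsTorsion τ₀ τ₁ τ₂ τ₃)
    (hf : φ.IsCoassociative f) (p : S) :
    ∃ γ : Lam27Inv (φ.tangentPlane f p),
      IsInvComponent (φ.tangentPlane f p) (φ.toModel (τ₃ (f p))) γ ∧
      (∀ γ', IsInvComponent (φ.tangentPlane f p) (φ.toModel (τ₃ (f p))) γ' → γ' = γ) ∧
      τ₀ (f p) = -(√42 / 7) * dagger (φ.tangentPlane f p) γ := by
  have hC := hf.coassociative p
  have h1 : wedge (φ.toModel (τ₃ (f p))) phi0 = 0 := by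
    rw [← toModel_form φ (f p), ← toModel_wedge, hτ.tau3_mem]
    rfl
  have h2 : wedge (φ.toModel (τ₃ (f p))) starPhi0 = 0 := by
    rw [← toModel_starForm φ (f p), ← toModel_wedge, hτ.tau3_mem']
    rfl
  let b : OrthonormalBasis (Fin 4) ℝ (φ.tangentPlane f p) :=
    (stdOrthonormalBasis ℝ _).reindex (finCongr hC.1)
  obtain ⟨γ, hγ, huniq, hstar⟩ := G2.exists_unique_invComponent hC h1 h2 b
  refine ⟨γ, hγ, huniq, ?_⟩
  have h := hτ.tau0_mul_starPhi0_add hf p fun i => (b i).2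
  rw [hstar] at h
  -- The value is `±1` on an orthonormal basis of the tangent plane, so it cancels from `τ₀ *φ + *τ₃
  -- = 0`.
  have hb : starPhi0 (fun i => (b i : V)) ≠ 0 := fun h0 => by
    have := hC.2 b
    rw [h0, abs_zero] at this
    exact zero_ne_one this
  apply mul_right_cancel₀ hb
  linear_combination h

end G2Structure

end G2

end

theorem theorem2p10 {M : Type*} [TopologicalSpace M] [ChartedSpace G2.V M]
    [IsManifold 𝓘(ℝ, G2.V) ∞ M] (φ : G2.G2Structure M)
    (τ₀ : M → ℝ) (τ₁ : G2.FormField M 1) (τ₂ : G2.FormField M 2) (τ₃ : G2.FormField M 3)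
    (hτ : φ.IsTorsion τ₀ τ₁ τ₂ τ₃) :
    (∀ (S : Type*) [TopologicalSpace S] [ChartedSpace G2.R4 S] [IsManifold 𝓘(ℝ, G2.R4) ∞ S]
      (f : S → M), φ.IsCoassociative f → ∀ p : S,
        ∃ γ : G2.Lam27Inv (φ.tangentPlane f p),
          G2.IsInvComponent (φ.tangentPlane f p) (φ.toModel (τ₃ (f p))) γ ∧
          (∀ γ', G2.IsInvComponent (φ.tangentPlane f p) (φ.toModel (τ₃ (f p))) γ' → γ' = γ) ∧
          τ₀ (f p) = -(√42 / 7) * G2.dagger (φ.tangentPlane f p) γ) ∧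
    (∀ U : Set M, IsOpen U → (∀ x ∈ U, τ₃ x = 0) → (∀ x ∈ U, τ₀ x ≠ 0) →
      ∀ (S : Type*) [TopologicalSpace S] [ChartedSpace G2.R4 S] [IsManifold 𝓘(ℝ, G2.R4) ∞ S]
        [Nonempty S] (f : S → M), φ.IsCoassociative f → ¬ Set.range f ⊆ U) := by
  refine ⟨fun S _ _ _ f hf p => hτ.exists_unique_invComponent hf p,
    fun U _ h3 h0 S _ _ _ _ f hf hU => ?_⟩
  obtain ⟨p⟩ := ‹Nonempty S›
  have hp : f p ∈ U := hU ⟨p, rfl⟩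
  obtain ⟨γ, -, huniq, hγ⟩ := hτ.exists_unique_invComponent hf p
  have hi : ∀ h : LinearMap.BilinForm ℝ G2.V, h = 0 → G2.iMap h = 0 := by
    rintro _ rfl
    simp [G2.iMap]
  have hz : ∀ T : Submodule ℝ G2.V, (0 : LinearMap.BilinForm ℝ G2.V) ∈ G2.Sym20 T := fun T =>
    ⟨fun _ _ => rfl, fun _ _ _ => rfl, by simp [G2.trace]⟩
  -- The zero form decomposes into zero pieces, so uniqueness forces its invariant component, and
  -- with it `τ₀`, to vanish.
  have hγ0 : 0 = γ := huniq 0 ⟨0, hz _, 0, hz _, 0,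
    ⟨fun _ _ => rfl, fun _ _ _ _ => rfl, fun _ _ _ _ => rfl⟩, by
      rw [h3 _ hp, hi 0 rfl]
      ext v
      simp [G2.G2Structure.toModel_apply]⟩
  apply h0 _ hp
  rw [hγ, ← hγ0, map_zero, mul_zero]
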